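/- Let $\langle\cdot,\cdot\rangle$ be the standard scalar product of $\mathbb{R}^n$, and let $\Delta\subset\mathbb{R}^n$ be a polytope of dimension $n$ (a non-empty bounded intersection of finitely many closed halfspaces whose affine hull is $\mathbb{R}^n$) and $u\in\mathbb{R}^n$. An \emph{aggregate} of $\Delta$ in the direction $u$ is a non-empty set that, for some $c\in\mathbb{R}$, is the union of all faces of $\Delta$ (including $\Delta$ itself) contained in $\{x : \langle u,x\rangle=c\}$; thus for $u=0$ the only aggregate is $\Delta$. Let $\Delta(u)$ be the set of aggregates. For $V\in\Delta(u)$, let $\langle u,V\rangle$ be the common value of $\langle u,x\rangle$ for $x\in V$, and let $\dim V$ be the largest dimension of a face of $\Delta$ contained in $V$. For a facet $F$ of $\Delta$ let $L_F$ be the linear hyperplane parallel to $F$, $\pi_F$ the orthogonal projection onto $L_F$, and $u_F$ the inner normal vector to $F$ of norm $1$; choosing a point $m_F\in F$, one views $F$ as the $(n-1)$-dimensional polytope $F-m_F$ in the Euclidean space $L_F$ (and translates subsets of $F$ accordingly). Real numbers $C_k(\Delta,u,V)$, $k\ge 0$, are defined recursively on $n$ as follows. Set $C_k(\Delta,u,\emptyset)=0$,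 and $C_k(\Delta,u,V)=0$ for $k>\dim V$. If $u=0$ (so $V=\Delta$), then $C_n(\Delta,0,\Delta)=\operatorname{vol}_n(\Delta)$ and $C_k(\Delta,0,\Delta)=0$ for $k<n$. If $u\neq0$, then for $0\le k\le \dim V$ $$C_k(\Delta,u,V)=-\sum_{F}\frac{\langle u_F,u\rangle}{\|u\|^2}\,C_k(F,\pi_F(u),V\cap F),$$ the sum being over the facets $F$ of $\Delta$. Put $C(\Delta,u,V)(z)=\sum_{k=0}^{\dim V}\frac{k!}{(\dim V)!}\,C_k(\Delta,u,V)\,z^{\dim V-k}\in\mathbb{R}[z]$. 1. The set $\Delta(u)$ is finite, and for every $n$ times continuously differentiable $f:\mathbb{R}\to\mathbb{R}$, $$\int_\Delta f^{(n)}(\langle u,x\rangle)\,dx=\sum_{V\in\Delta(u)}\frac{d^{\dim V}}{dz^{\dim V}}\Big|_{z=0}\Big(C(\Delta,u,V)(z)\, f(z+\langle u,V\rangle)\Big)=\sum_{V\in\Delta(u)}\sum_{k=0}^{n}C_k(\Delta,u,V)\,f^{(k)}(\langle u,V\rangle).$$ 2. The coefficients are uniquely determined by this identity: if real numbers $c_{V,k}$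 ($V\in\Delta(u)$, $0\le k\le n$) satisfy $\int_\Delta f^{(n)}(\langle u,x\rangle)\,dx=\sum_{V\in\Delta(u)}\sum_{k=0}^{n}c_{V,k}f^{(k)}(\langle u,V\rangle)$ for every $f\in\mathscr{C}^n(\mathbb{R})$, then $c_{V,k}=C_k(\Delta,u,V)$ for all $V\in\Delta(u)$ and $0\le k\le n$. 3. (Brion's formula.) Let $\Delta$ be an $n$-dimensional simplex with vertices $\nu_0,\dots,\nu_n$ and suppose $\langle u,\nu_i\rangle\ne\langle u,\nu_j\rangle$ for $i\ne j$. Then $\Delta(u)=\{\{\nu_0\},\dots,\{\nu_n\}\}$, $C_0(\Delta,u,\{\nu_i\})=n!\operatorname{vol}_n(\Delta)\prod_{j\neq i}\langle\nu_i-\nu_j,u\rangle^{-1}$ and $C_k(\Delta,u,\{\nu_i\})=0$ for $k\ge1$; hence, for every $f\in\mathscr{C}^n(\mathbb{R})$, $$\int_\Delta f^{(n)}(\langle u,x\rangle)\,dx=n!\operatorname{vol}_n(\Delta)\sum_{i=0}^n\frac{f(\langle u,\nu_i\rangle)}{\prod_{j\ne i}\langle\nu_i-\nu_j,u\rangle}.$$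 -/

import Mathlib

open MeasureTheory
open scoped RealInnerProductSpace

noncomputable section

namespace PolytopeIntegration

universe u

section Polytopes

variable {E : Type u} [NormedAddCommGroup E] [InnerProductSpace ℝ E]

/-- A polytope: a nonempty bounded set that is the intersection of finitely many closed
halfspaces `{x | 0 ≤ ⟪a, x⟫ + α}`. -/
def IsPolytope (P : Set E) : Prop :=
  P.Nonempty ∧ Bornology.IsBounded P ∧
    ∃ H : Finset (E × ℝ), P = {x | ∀ h ∈ H, 0 ≤ ⟪h.1, x⟫ + h.2}

/-- The dimension of a (nonempty) convex set: the dimension of its affine hull. -/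
def setDim (S : Set E) : ℕ := Module.finrank ℝ (vectorSpan ℝ S)

/-- Faces of a convex set (nonempty convex extreme subsets; the set itself is a face). -/
def IsFace (P F : Set E) : Prop := F.Nonempty ∧ Convex ℝ F ∧ IsExtreme ℝ P F

/-- The set of facets, that is, of faces of codimension one. -/
def facets (P : Set E) : Set (Set E) := {F | IsFace P F ∧ setDim F + 1 = setDim P}

/-- The union of the faces of `P` on which the linear form `⟪u, ·⟫` is constant, equal to `c`. -/
def levelUnion (P : Set E) (u : E) (c : ℝ) : Set E :=
  ⋃₀ {G | IsFace P G ∧ ∀ x ∈ G, ⟪u, x⟫ = c}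

/-- The set `Δ(u)` of aggregates of `P` in the direction `u`. For `u ≠ 0` the sets
`{x | ⟪u, x⟫ = c}` are the affine hyperplanes orthogonal to `u`; for `u = 0` the only
aggregate is `P` itself. -/
def aggregates (P : Set E) (u : E) : Set (Set E) :=
  {V | V.Nonempty ∧ ∃ c : ℝ, V = levelUnion P u c}

open Classical in
/-- The common value `⟪u, V⟫` of `⟪u, ·⟫` at the points of an aggregate `V`. -/
def value (u : E) (V : Set E) : ℝ := if h : V.Nonempty then ⟪u, h.some⟫ else 0

/-- The dimension of an aggregate `V` of `P`: the largest dimension of a face of `P`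
contained in `V`. -/
def aggDim (P V : Set E) : ℕ := sSup {d | ∃ G, IsFace P G ∧ G ⊆ V ∧ d = setDim G}

open Classical in
/-- A point `m_F` chosen in `F`. -/
def basePoint (F : Set E) : E := if h : F.Nonempty then h.some else 0

/-- The translate `S - m_F`, for `S ⊆ F`, as a subset of the linear subspace `L_F` that is
parallel to the affine hull of `F`. -/
def translate (F S : Set E) : Set (vectorSpan ℝ F) := {y | (y : E) + basePoint F ∈ S}

open Classical in
/-- The unit vector that is normal to the facet `F` of `P` and points into `P`. -/
def innerNormal (P F : Set E) : E :=
  if h : ∃ v : E, ‖v‖ = 1 ∧ (∀ w ∈ vectorSpan ℝ F, ⟪v, w⟫ = 0) ∧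
      ∀ x ∈ P, ∀ y ∈ F, ⟪v, y⟫ ≤ ⟪v, x⟫
  then h.choose else 0

end Polytopes

open Classical in
/-- The coefficient `C_k(P, u, V)`, for a polytope `P` of dimension `n` in an `n`-dimensional
Euclidean space `E`, by recursion over the facets of `P`. Each facet is translated to a
full-dimensional polytope in its linear hyperplane `L_F`, onto which `u` is projected
orthogonally. (In dimension `0` one always has `u = 0`, so the last value there is never used.) -/
def aggCoeff : (n : ℕ) → (E : Type u) → [NormedAddCommGroup E] → [InnerProductSpace ℝ E] →
    [FiniteDimensional ℝ E] → [MeasurableSpace E] → [BorelSpace E] →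
    (P : Set E) → (u : E) → (V : Set E) → (k : ℕ) → ℝ
  | 0, _, _, _, _, _, _, P, u, V, k =>
    if V = ∅ ∨ aggDim P V < k then 0
    else if u = 0 then (if k = 0 then (volume P).toReal else 0)
    else 0
  | n + 1, _, _, _, _, _, _, P, u, V, k =>
    if V = ∅ ∨ aggDim P V < k then 0
    else if u = 0 then (if k = n + 1 then (volume P).toReal else 0)
    else -∑ᶠ F ∈ facets P, ⟪innerNormal P F, u⟫ / ‖u‖ ^ 2 *
      aggCoeff n (vectorSpan ℝ F) (translate F F)
        ((vectorSpan ℝ F).orthogonalProjectionOnto u) (translate F (V ∩ F)) k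

/-- `C_k(Δ, u, V)` for a polytope `Δ` of dimension `n` in `ℝⁿ`. -/
def C {n : ℕ} (Δ : Set (EuclideanSpace ℝ (Fin n))) (u : EuclideanSpace ℝ (Fin n))
    (V : Set (EuclideanSpace ℝ (Fin n))) (k : ℕ) : ℝ :=
  aggCoeff n (EuclideanSpace ℝ (Fin n)) Δ u V k

open Nat in
/-- The polynomial `C(Δ, u, V) = ∑ k ≤ dim V, (k! / (dim V)!) C_k(Δ, u, V) z ^ (dim V - k)`. -/
def CPoly {n : ℕ} (Δ : Set (EuclideanSpace ℝ (Fin n))) (u : EuclideanSpace ℝ (Fin n))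
    (V : Set (EuclideanSpace ℝ (Fin n))) : Polynomial ℝ :=
  ∑ k ∈ Finset.range (aggDim Δ V + 1),
    Polynomial.C (((k ! : ℕ) : ℝ) / (((aggDim Δ V) ! : ℕ) : ℝ) * C Δ u V k) *
      Polynomial.X ^ (aggDim Δ V - k)

end PolytopeIntegration

end

noncomputable section

namespace PolytopeIntegration

universe u

/-! ### Faces of polytopes -/

section Geometry

variable {E : Type u} [NormedAddCommGroup E] [InnerProductSpace ℝ E] {P F G : Set E}

/-! The formula is the divergence theorem, iterated. With g = f⁽ⁿ⁻¹⁾, the field g(⟪u, x⟫) u has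
divergence ‖u‖² f⁽ⁿ⁾(⟪u, x⟫), so the integral over Δ becomes a sum of integrals over the facets
(`setIntegral_deriv_eq_sum_facets`). Each of these is of the same kind in dimension n - 1, for the
projected direction and a translate of f. An aggregate meets a facet in an aggregate of that facet
or not at all (`levelUnion_inter_face`), so induction reproduces the recursion that defines the
coefficients (`setIntegral_iteratedDeriv_eq_sum_levels`).

The divergence theorem is obtained by cutting Δ into cones over its facets, with apex an interior
point a, and integrating along rays; this treats the field g(⟪u, x⟫) (x - a)
(`setIntegral_eq_sum_facets_of_apex`). Subtracting the identities for two apexes that differ by a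
small multiple of u leaves the field g(⟪u, x⟫) u.

Distinct aggregates have distinct values, so a function supported near one value and equal to a
power of z - c close to it isolates a single coefficient. On a simplex with a separating direction
only vertices contribute, and only with k = 0; a monic polynomial of degree n vanishing at the
values of the other vertices then computes the coefficient. -/

theorem convex_halfspaces (H : Finset (E × ℝ)) :
    Convex ℝ {x : E | ∀ h ∈ H, 0 ≤ ⟪h.1, x⟫ + h.2} := by
  intro x hx y hy s t hs ht hst h hh
  have h1 := mul_nonneg hs (hx h hh)
  have h2 := mul_nonneg ht (hy h hh)
  rw [inner_add_right, inner_smul_right, inner_smul_right]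
  have : h.2 = s * h.2 + t * h.2 := by rw [← add_mul, hst, one_mul]
  linarith

theorem IsPolytope.convex (hP : IsPolytope P) : Convex ℝ P := by
  obtain ⟨-, -, H, rfl⟩ := hP
  exact convex_halfspaces H

theorem IsPolytope.isClosed (hP : IsPolytope P) : IsClosed P := by
  obtain ⟨-, -, H, rfl⟩ := hP
  have : {x : E | ∀ h ∈ H, 0 ≤ ⟪h.1, x⟫ + h.2} = ⋂ h ∈ H, {x | 0 ≤ ⟪h.1, x⟫ + h.2} := by
    ext x; simp
  rw [this]
  exact isClosed_biInter fun h _ => isClosed_le continuous_const (by fun_prop)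

theorem IsPolytope.isCompact [FiniteDimensional ℝ E] (hP : IsPolytope P) : IsCompact P :=
  Metric.isCompact_of_isClosed_isBounded hP.isClosed hP.2.1

theorem IsFace.subset (h : IsFace P F) : F ⊆ P := h.2.2.subset

theorem IsFace.refl (hP : IsPolytope P) : IsFace P P := ⟨hP.1, hP.convex, IsExtreme.rfl⟩

theorem IsFace.trans (hF : IsFace P F) (hG : IsFace F G) : IsFace P G :=
  ⟨hG.1, hG.2.1, hF.2.2.trans hG.2.2⟩

theorem IsFace.inter (hF : IsFace P F) (hG : IsFace P G) (h : (G ∩ F).Nonempty) :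
    IsFace F (G ∩ F) := by
  refine ⟨h, hG.2.1.inter hF.2.1, Set.inter_subset_right, fun x hx y hy z hz hxy => ⟨?_, hx⟩⟩
  exact hG.2.2.left_mem_of_mem_openSegment (hF.subset hx) (hF.subset hy) hz.1 hxy

/-- A face of an intersection of halfspaces is cut out by the constraints that are active on it. -/
theorem mem_face_of_active {H : Finset (E × ℝ)} (hP : P = {x | ∀ h ∈ H, 0 ≤ ⟪h.1, x⟫ + h.2})
    (hG : IsFace P G) {x : E} (hx : x ∈ P)
    (hact : ∀ h ∈ H, (∀ z ∈ G, ⟪h.1, z⟫ + h.2 = 0) → ⟪h.1, x⟫ + h.2 = 0) : x ∈ G := by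
  classical
  have hGP := hG.subset
  -- Taking midpoints successively produces one point of `G` at which every constraint that is not
  -- identically active on `G` is strict.
  have key : ∀ S : Finset (E × ℝ), S ⊆ H → ∃ y ∈ G, ∀ h ∈ S,
      (∃ z ∈ G, ⟪h.1, z⟫ + h.2 ≠ 0) → 0 < ⟪h.1, y⟫ + h.2 := by
    intro S
    induction S using Finset.induction_on with
    | empty => intro _; obtain ⟨y, hy⟩ := hG.1; exact ⟨y, hy, by simp⟩
    | insert h S _ ih =>
      intro hS
      obtain ⟨y, hy, hyS⟩ := ih ((Finset.subset_insert _ _).trans hS)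
      by_cases hz : ∃ z ∈ G, ⟪h.1, z⟫ + h.2 ≠ 0
      · obtain ⟨z, hzG, hz⟩ := hz
        have hyP := hGP hy
        have hzP := hGP hzG
        rw [hP] at hyP hzP
        have val : ∀ h : E × ℝ, ⟪h.1, (1/2 : ℝ) • y + (1/2 : ℝ) • z⟫ + h.2 =
            1/2 * (⟪h.1, y⟫ + h.2) + 1/2 * (⟪h.1, z⟫ + h.2) := by
          intro h; rw [inner_add_right, inner_smul_right, inner_smul_right]; ring
        refine ⟨(1/2 : ℝ) • y + (1/2 : ℝ) • z,
          hG.2.1 hy hzG (by norm_num) (by norm_num) (by norm_num), fun k hk hk' => ?_⟩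
        rw [val]
        have h1 := hyP k (hS hk)
        have h2 := hzP k (hS hk)
        rcases Finset.mem_insert.1 hk with rfl | hkS
        · have := lt_of_le_of_ne h2 (Ne.symm hz); linarith
        · have := hyS k hkS hk'; linarith
      · refine ⟨y, hy, fun k hk hk' => ?_⟩
        rcases Finset.mem_insert.1 hk with rfl | hkS
        · exact absurd hk' hz
        · exact hyS k hkS hk'
  obtain ⟨y, hyG, hy⟩ := key H subset_rfl
  have hyP := hGP hyG
  -- The segment from `x` to `y` can be prolonged beyond `y` inside `P`: strict constraints survive
  -- a small move, the others vanish along the whole line. Then `y` lies between `x` and a point of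
  -- `P`, and extremality gives `x ∈ G`.
  have ev : ∀ᶠ ε : ℝ in nhdsWithin 0 (Set.Ioi 0), ∀ h ∈ H, 0 ≤ ⟪h.1, y + ε • (y - x)⟫ + h.2 := by
    rw [Filter.eventually_all_finset]
    intro h hh
    by_cases hz : ∃ z ∈ G, ⟪h.1, z⟫ + h.2 ≠ 0
    · have cont : Continuous fun ε : ℝ => ⟪h.1, y + ε • (y - x)⟫ + h.2 := by fun_prop
      have h0 : 0 < (fun ε : ℝ => ⟪h.1, y + ε • (y - x)⟫ + h.2) 0 := by simpa using hy h hh hz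
      exact ((cont.continuousAt.eventually_const_lt h0).filter_mono nhdsWithin_le_nhds).mono
        fun ε hε => hε.le
    · push Not at hz
      have hx0 := hact h hh hz
      have hy0 := hz y hyG
      refine Filter.Eventually.of_forall fun ε => le_of_eq ?_
      rw [inner_add_right, inner_smul_right, inner_sub_right]
      have : ⟪h.1, y⟫ - ⟪h.1, x⟫ = 0 := by linarith
      rw [this]; linarith
  obtain ⟨ε, hε, hε0⟩ := (ev.and self_mem_nhdsWithin).exists
  have hε0 : 0 < ε := hε0
  have hw : y + ε • (y - x) ∈ P := by rw [hP]; exact hε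
  refine hG.2.2.left_mem_of_mem_openSegment hx hw hyG
    ⟨ε / (1 + ε), 1 / (1 + ε), by positivity, by positivity, by field_simp; ring, ?_⟩
  have h1 : (1 + ε) ≠ 0 := by positivity
  rw [← sub_eq_zero]
  have : (ε / (1 + ε)) • x + (1 / (1 + ε)) • (y + ε • (y - x)) - y =
      (ε / (1 + ε) - 1 / (1 + ε) * ε) • x + (1 / (1 + ε) * (1 + ε) - 1) • y := by module
  rw [this]
  have e1 : ε / (1 + ε) - 1 / (1 + ε) * ε = 0 := by ring
  have e2 : 1 / (1 + ε) * (1 + ε) - 1 = 0 := by field_simp; ring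
  rw [e1, e2]; simp

/-- A face is determined by the set of constraints active on it, a subset of `H`. -/
theorem IsPolytope.finite_faces (hP : IsPolytope P) : {G | IsFace P G}.Finite := by
  classical
  obtain ⟨-, -, H, hH⟩ := hP
  refine Set.Finite.of_finite_image
    (f := fun G => H.filter fun h => ∀ z ∈ G, ⟪h.1, z⟫ + h.2 = 0)
    ((H.powerset : Set (Finset (E × ℝ))).toFinite.subset ?_) ?_
  · rintro _ ⟨G, -, rfl⟩
    exact Finset.mem_coe.2 (Finset.mem_powerset.2 (Finset.filter_subset _ _))
  · have aux : ∀ G G' : Set E, IsFace P G → IsFace P G' →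
        H.filter (fun h => ∀ z ∈ G, ⟪h.1, z⟫ + h.2 = 0) =
          H.filter (fun h => ∀ z ∈ G', ⟪h.1, z⟫ + h.2 = 0) → G ⊆ G' := by
      intro G G' hG hG' he x hx
      refine mem_face_of_active hH hG' (hG.subset hx) fun h hh hz => ?_
      have : h ∈ H.filter (fun h => ∀ z ∈ G', ⟪h.1, z⟫ + h.2 = 0) :=
        Finset.mem_filter.2 ⟨hh, hz⟩
      rw [← he] at this
      exact (Finset.mem_filter.1 this).2 x hx
    intro G hG G' hG' he
    exact (aux G G' hG hG' he).antisymm (aux G' G hG' hG he.symm)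

/-- Adjoining the reverses of the active inequalities to those of `P` cuts out the face. -/
theorem IsFace.isPolytope (hP : IsPolytope P) (hF : IsFace P F) : IsPolytope F := by
  classical
  obtain ⟨-, hb, H, hH⟩ := hP
  refine ⟨hF.1, hb.subset hF.subset, H ∪ (H.filter fun h => ∀ z ∈ F, ⟪h.1, z⟫ + h.2 = 0).image
    (fun h => (-h.1, -h.2)), ?_⟩
  ext x
  constructor
  · intro hx h hh
    have hxP := hF.subset hx
    rw [hH] at hxP
    rcases Finset.mem_union.1 hh with hh | hh
    · exact hxP h hh
    · obtain ⟨k, hk, rfl⟩ := Finset.mem_image.1 hh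
      have := (Finset.mem_filter.1 hk).2 x hx
      simp only [inner_neg_left]
      linarith
  · intro hx
    have hxP : x ∈ P := by
      rw [hH]; intro h hh; exact hx h (Finset.mem_union_left _ hh)
    refine mem_face_of_active hH hF hxP fun h hh hz => le_antisymm ?_ ?_
    · have := hx (-h.1, -h.2) (Finset.mem_union_right _
        (Finset.mem_image.2 ⟨h, Finset.mem_filter.2 ⟨hh, hz⟩, rfl⟩))
      simp only [inner_neg_left] at this
      linarith
    · exact hx h (Finset.mem_union_left _ hh)

/-! ### Polar description around an interior point -/

/-- Every constraint with nonzero normal is strict at an interior point, so it can be divided by its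
value at `a`. Constraints with zero normal hold everywhere and are dropped. -/
theorem exists_polar (hP : IsPolytope P) {a : E} (ha : a ∈ interior P) :
    ∃ B : Finset E, 0 ∉ B ∧ P = {x | ∀ b ∈ B, ⟪b, x - a⟫ ≤ 1} := by
  classical
  obtain ⟨-, -, H, hH⟩ := hP
  have haP : a ∈ P := interior_subset ha
  have hpos : ∀ h ∈ H, h.1 ≠ 0 → 0 < ⟪h.1, a⟫ + h.2 := by
    intro h hh h0
    have cont : Continuous fun ε : ℝ => a - ε • h.1 := by fun_prop
    have ev : ∀ᶠ ε : ℝ in nhdsWithin 0 (Set.Ioi 0), a - ε • h.1 ∈ P :=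
      (cont.continuousAt.eventually (by simpa using mem_interior_iff_mem_nhds.1 ha)).filter_mono
        nhdsWithin_le_nhds
    obtain ⟨ε, hε, hε0⟩ := (ev.and self_mem_nhdsWithin).exists
    have hε0 : 0 < ε := hε0
    rw [hH] at hε
    have h1 := hε h hh
    rw [inner_sub_right, inner_smul_right, real_inner_self_eq_norm_sq] at h1
    have : 0 < ε * ‖h.1‖ ^ 2 := by have := norm_pos_iff.2 h0; positivity
    linarith
  refine ⟨(H.filter fun h => h.1 ≠ 0).image fun h => -((⟪h.1, a⟫ + h.2)⁻¹ • h.1), ?_, ?_⟩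
  · intro h0
    obtain ⟨h, hh, he⟩ := Finset.mem_image.1 h0
    obtain ⟨hh, hne⟩ := Finset.mem_filter.1 hh
    rw [neg_eq_zero, smul_eq_zero, inv_eq_zero] at he
    exact he.elim (hpos h hh hne).ne' hne
  · have iff : ∀ x, ∀ h ∈ H, h.1 ≠ 0 →
        (⟪-((⟪h.1, a⟫ + h.2)⁻¹ • h.1), x - a⟫ ≤ 1 ↔ 0 ≤ ⟪h.1, x⟫ + h.2) := by
      intro x h hh hne
      have := hpos h hh hne
      rw [inner_neg_left, real_inner_smul_left, inner_sub_right, ← sub_nonneg,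
        ← mul_nonneg_iff_of_pos_left this]
      have e : (⟪h.1, a⟫ + h.2) * (1 - -((⟪h.1, a⟫ + h.2)⁻¹ * (⟪h.1, x⟫ - ⟪h.1, a⟫))) =
          ⟪h.1, x⟫ + h.2 := by field_simp; ring
      rw [e]
    rw [hH] at haP ⊢
    ext x
    constructor
    · intro hx b hb
      obtain ⟨h, hh, rfl⟩ := Finset.mem_image.1 hb
      obtain ⟨hh, hne⟩ := Finset.mem_filter.1 hh
      exact (iff x h hh hne).2 (hx h hh)
    · intro hx h hh
      by_cases hne : h.1 = 0
      · have := haP h hh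
        rw [hne, inner_zero_left] at this ⊢
        exact this
      · exact (iff x h hh hne).1 (hx _ (Finset.mem_image.2 ⟨h, Finset.mem_filter.2 ⟨hh, hne⟩, rfl⟩))

/-- The part of `P` on the hyperplane `⟪b, x - a⟫ = 1`. -/
def polarFace (P : Set E) (a b : E) : Set E := {x | x ∈ P ∧ ⟪b, x - a⟫ = 1}

theorem isFace_polarFace {B : Finset E} {a b : E} (hP : P = {x | ∀ b ∈ B, ⟪b, x - a⟫ ≤ 1})
    (hc : Convex ℝ P) (hb : b ∈ B) (hne : (polarFace P a b).Nonempty) :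
    IsFace P (polarFace P a b) := by
  have val : ∀ (s t : ℝ) (x y : E), s + t = 1 →
      ⟪b, s • x + t • y - a⟫ = s * ⟪b, x - a⟫ + t * ⟪b, y - a⟫ := by
    intro s t x y hst
    have : s • x + t • y - a = s • (x - a) + t • (y - a) + (s + t - 1) • a := by module
    rw [this, hst, sub_self, zero_smul, add_zero, inner_add_right, inner_smul_right,
      inner_smul_right]
  refine ⟨hne, fun x hx y hy s t hs ht hst => ⟨hc hx.1 hy.1 hs ht hst, ?_⟩,
    fun x hx => hx.1, fun x hx y hy z hz hxy => ⟨hx, ?_⟩⟩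
  · rw [val s t x y hst, hx.2, hy.2]; linarith
  · obtain ⟨s, t, hs, ht, hst, rfl⟩ := hxy
    have h1 := hz.2
    rw [val s t x y hst] at h1
    rw [hP] at hx hy
    have h2 := hx b hb
    have h3 := hy b hb
    nlinarith

theorem inner_vectorSpan_eq_zero {S : Set E} {b : E} {c : ℝ} (h : ∀ x ∈ S, ⟪b, x⟫ = c) {w : E}
    (hw : w ∈ vectorSpan ℝ S) : ⟪b, w⟫ = 0 := by
  have : vectorSpan ℝ S ≤ (ℝ ∙ b)ᗮ := by
    rw [vectorSpan_def, Submodule.span_le]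
    rintro _ ⟨x, hx, y, hy, rfl⟩
    rw [SetLike.mem_coe, Submodule.mem_orthogonal_singleton_iff_inner_right]
    change ⟪b, x - y⟫ = 0
    rw [inner_sub_right, h x hx, h y hy, sub_self]
  exact Submodule.mem_orthogonal_singleton_iff_inner_right.1 (this hw)

theorem polarFace_inner_vectorSpan {a b w : E} (hw : w ∈ vectorSpan ℝ (polarFace P a b)) :
    ⟪b, w⟫ = 0 := by
  refine inner_vectorSpan_eq_zero (c := 1 + ⟪b, a⟫) (fun x hx => ?_) hw
  have := hx.2
  rw [inner_sub_right] at this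
  linarith

theorem finrank_orthogonal_singleton [FiniteDimensional ℝ E] {b : E} (hb : b ≠ 0) :
    Module.finrank ℝ ((ℝ ∙ b)ᗮ : Submodule ℝ E) + 1 = Module.finrank ℝ E := by
  rw [← (ℝ ∙ b).finrank_add_finrank_orthogonal, finrank_span_singleton hb, add_comm]

theorem setDim_polarFace_lt [FiniteDimensional ℝ E] {a b : E} (hb : b ≠ 0) :
    setDim (polarFace P a b) + 1 ≤ Module.finrank ℝ E := by
  rw [← finrank_orthogonal_singleton hb]
  refine Nat.succ_le_succ (Submodule.finrank_mono fun w hw => ?_)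
  exact Submodule.mem_orthogonal_singleton_iff_inner_right.2 (polarFace_inner_vectorSpan hw)

theorem vectorSpan_polarFace [FiniteDimensional ℝ E] {a b : E} (hb : b ≠ 0)
    (hd : setDim (polarFace P a b) + 1 = Module.finrank ℝ E) :
    vectorSpan ℝ (polarFace P a b) = (ℝ ∙ b)ᗮ := by
  refine Submodule.eq_of_le_of_finrank_eq (fun w hw => ?_) ?_
  · exact Submodule.mem_orthogonal_singleton_iff_inner_right.2 (polarFace_inner_vectorSpan hw)
  · have := finrank_orthogonal_singleton hb
    unfold setDim at hd
    omega

/-- The direction of a facet determines `b` up to a scalar, and the normalization to the value 1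
fixes the scalar. Hence no facet is counted twice. -/
theorem polarFace_injective [FiniteDimensional ℝ E] {a b b' : E} (hb : b ≠ 0)
    (hd : setDim (polarFace P a b) + 1 = Module.finrank ℝ E) (hne : (polarFace P a b).Nonempty)
    (hsub : polarFace P a b ⊆ polarFace P a b') : b = b' := by
  have h1 := vectorSpan_polarFace hb hd
  have h2 : (ℝ ∙ b)ᗮ ≤ (ℝ ∙ b')ᗮ := by
    rw [← h1]
    intro w hw
    exact Submodule.mem_orthogonal_singleton_iff_inner_right.2
      (polarFace_inner_vectorSpan (vectorSpan_mono ℝ hsub hw))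
  have h3 : (ℝ ∙ b') ≤ (ℝ ∙ b) := Submodule.orthogonal_le_orthogonal_iff.1 h2
  obtain ⟨r, hr⟩ := Submodule.mem_span_singleton.1 (h3 (Submodule.mem_span_singleton_self b'))
  obtain ⟨x, hx⟩ := hne
  have hx' := (hsub hx).2
  rw [← hr, real_inner_smul_left, hx.2, mul_one] at hx'
  rw [← hr, hx', one_smul]

/-- If no constraint were active on all of `F`, then `F` would be `P`. An active `b` has `F`
spanning the directions of its hyperplane, so any other active constraint coincides with `b`, and
`b` alone cuts out `F`. -/
theorem facet_eq_polarFace [FiniteDimensional ℝ E] {B : Finset E} {a : E} (hB : 0 ∉ B)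
    (hP : P = {x | ∀ b ∈ B, ⟪b, x - a⟫ ≤ 1}) (hdim : setDim P = Module.finrank ℝ E)
    (hF : F ∈ facets P) : ∃ b ∈ B, F = polarFace P a b := by
  classical
  obtain ⟨hF, hd⟩ := hF
  have hP' : P = {x | ∀ h ∈ B.image (fun b => (-b, 1 + ⟪b, a⟫)), 0 ≤ ⟪h.1, x⟫ + h.2} := by
    rw [hP]; ext x
    simp only [Set.mem_ofPred_eq, Finset.forall_mem_image, inner_neg_left, inner_sub_right]
    exact forall₂_congr fun b _ => by constructor <;> intro h <;> linarith
  have act : ∀ {x}, x ∈ P → (∀ b ∈ B, (∀ z ∈ F, ⟪b, z - a⟫ = 1) → ⟪b, x - a⟫ = 1) → x ∈ F := by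
    intro x hx hxa
    refine mem_face_of_active hP' hF hx ?_
    rw [Finset.forall_mem_image]
    intro b hb hz
    have := hxa b hb fun z hzF => by
      have := hz z hzF
      simp only [inner_neg_left] at this
      rw [inner_sub_right]; linarith
    simp only [inner_neg_left]
    rw [inner_sub_right] at this
    linarith
  by_cases hex : ∃ b ∈ B, ∀ z ∈ F, ⟪b, z - a⟫ = 1
  · obtain ⟨b, hb, hbF⟩ := hex
    have hb0 : b ≠ 0 := fun h => hB (h ▸ hb)
    have hFb : F ⊆ polarFace P a b := fun z hz => ⟨hF.subset hz, hbF z hz⟩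
    have hdb : setDim (polarFace P a b) + 1 = Module.finrank ℝ E := by
      refine le_antisymm (setDim_polarFace_lt hb0) ?_
      rw [← hdim, ← hd]
      exact Nat.succ_le_succ (Submodule.finrank_mono (vectorSpan_mono ℝ hFb))
    have hspan : vectorSpan ℝ F = (ℝ ∙ b)ᗮ := by
      rw [← vectorSpan_polarFace hb0 hdb]
      refine Submodule.eq_of_le_of_finrank_eq (vectorSpan_mono ℝ hFb) ?_
      unfold setDim at hd hdb hdim
      omega
    refine ⟨b, hb, hFb.antisymm fun x hx => act hx.1 fun b' hb' hb'F => ?_⟩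
    have hle : (ℝ ∙ b)ᗮ ≤ (ℝ ∙ b')ᗮ := by
      rw [← hspan]
      intro w hw
      refine Submodule.mem_orthogonal_singleton_iff_inner_right.2
        (inner_vectorSpan_eq_zero (c := 1 + ⟪b', a⟫) (fun x hx => ?_) hw)
      have := hb'F x hx
      rw [inner_sub_right] at this
      linarith
    obtain ⟨r, hr⟩ := Submodule.mem_span_singleton.1
      (Submodule.orthogonal_le_orthogonal_iff.1 hle (Submodule.mem_span_singleton_self b'))
    obtain ⟨z, hz⟩ := hF.1
    have h1 := hb'F z hz
    rw [← hr, real_inner_smul_left, hbF z hz, mul_one] at h1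
    rw [← hr, h1, one_smul, hx.2]
  · exfalso
    push Not at hex
    have : F = P := hF.subset.antisymm fun x hx => act hx fun b hb hz =>
      absurd hz (by obtain ⟨z, hz, hne⟩ := hex b hb; exact fun h => hne (h z hz))
    rw [this] at hd
    omega

/-! ### Translation of a face to its direction -/

theorem basePoint_mem {F : Set E} (h : F.Nonempty) : basePoint F ∈ F := by
  rw [basePoint, dif_pos h]; exact h.some_mem

theorem sub_basePoint_mem {x : E} (hx : x ∈ F) : x - basePoint F ∈ vectorSpan ℝ F :=
  vsub_mem_vectorSpan ℝ hx (basePoint_mem ⟨x, hx⟩)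

theorem mem_translate {S : Set E} {y : vectorSpan ℝ F} :
    y ∈ translate F S ↔ (y : E) + basePoint F ∈ S := Iff.rfl

theorem mem_iff_translate {S : Set E} {x : E} (hx : x ∈ F) :
    x ∈ S ↔ (⟨x - basePoint F, sub_basePoint_mem hx⟩ : vectorSpan ℝ F) ∈ translate F S := by
  rw [mem_translate]; simp

/-- The affine embedding of the direction of `F` that inverts the translation. -/
def embed (F : Set E) : vectorSpan ℝ F →ᵃ[ℝ] E :=
  (vectorSpan ℝ F).subtype.toAffineMap + AffineMap.const ℝ _ (basePoint F)

@[simp] theorem embed_apply (y : vectorSpan ℝ F) : embed F y = (y : E) + basePoint F := rfl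

theorem embed_injective : Function.Injective (embed F) := by
  intro x y h
  simpa using h

theorem embed_image_translate {S : Set E} (hS : S ⊆ F) : embed F '' translate F S = S := by
  ext x
  constructor
  · rintro ⟨y, hy, rfl⟩; exact hy
  · intro hx
    exact ⟨⟨_, sub_basePoint_mem (hS hx)⟩, (mem_iff_translate (hS hx)).1 hx, by simp⟩

theorem setDim_embed_image (S : Set (vectorSpan ℝ F)) : setDim (embed F '' S) = setDim S := by
  unfold setDim
  rw [← AffineMap.map_vectorSpan]
  have : (embed F).linear = (vectorSpan ℝ F).subtype := by
    ext y; simp [embed]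
  rw [this]
  exact Submodule.finrank_map_subtype_eq _ _

theorem setDim_translate {S : Set E} (hS : S ⊆ F) : setDim (translate F S) = setDim S := by
  rw [← setDim_embed_image, embed_image_translate hS]

theorem IsFace.translateFace (hG : IsFace F G) :
    IsFace (translate F F) (translate F G) := by
  refine ⟨?_, hG.2.1.affine_preimage (embed F), fun y hy => hG.subset hy,
    fun x hx y hy z hz hxy => ?_⟩
  · obtain ⟨x, hx⟩ := hG.1
    exact ⟨_, (mem_iff_translate (hG.subset hx)).1 hx⟩
  · refine hG.2.2.left_mem_of_mem_openSegment hx hy hz ?_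
    have := Set.mem_image_of_mem (embed F) hxy
    rwa [image_openSegment] at this

theorem IsFace.embed_image {G : Set (vectorSpan ℝ F)} (hG : IsFace (translate F F) G) :
    IsFace F (embed F '' G) := by
  refine ⟨hG.1.image _, hG.2.1.affine_image _, ?_, fun x hx y hy z hz hxy => ?_⟩
  · rintro _ ⟨y, hy, rfl⟩; exact hG.subset hy
  · obtain ⟨z, hz, rfl⟩ := hz
    rw [← embed_image_translate (F := F) subset_rfl] at hx hy
    obtain ⟨x, hx, rfl⟩ := hx
    obtain ⟨y, hy, rfl⟩ := hy
    rw [← image_openSegment] at hxy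
    exact ⟨x, hG.2.2.left_mem_of_mem_openSegment hx hy hz
      (embed_injective.mem_set_image.1 hxy), rfl⟩

theorem inner_orthogonalProjectionOnto (L : Submodule ℝ E) [L.HasOrthogonalProjection] (v : E)
    (y : L) : ⟪L.orthogonalProjectionOnto v, y⟫ = ⟪v, (y : E)⟫ :=
  Submodule.inner_orthogonalProjectionOnto_eq_of_mem_right y v

theorem IsPolytope.translateFace [FiniteDimensional ℝ E] (hF : IsPolytope F) :
    IsPolytope (translate F F) := by
  classical
  obtain ⟨hne, hb, H, hH⟩ := hF
  refine ⟨?_, ?_, H.image fun h => ((vectorSpan ℝ F).orthogonalProjectionOnto h.1,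
    ⟪h.1, basePoint F⟫ + h.2), ?_⟩
  · obtain ⟨x, hx⟩ := hne
    exact ⟨_, (mem_iff_translate hx).1 hx⟩
  · obtain ⟨R, hR⟩ := hb.exists_norm_le
    refine isBounded_iff_forall_norm_le.2 ⟨R + ‖basePoint F‖, fun y hy => ?_⟩
    have h1 := hR _ hy
    have h2 := norm_sub_le ((y : E) + basePoint F) (basePoint F)
    rw [add_sub_cancel_right] at h2
    rw [Submodule.coe_norm] at *
    linarith
  · ext y
    have e : y ∈ translate F F ↔
        ∀ h ∈ H, 0 ≤ ⟪h.1, (y : E) + basePoint F⟫ + h.2 := by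
      rw [mem_translate]; exact (Set.ext_iff.1 hH _)
    rw [e]
    simp only [Set.mem_ofPred_eq, Finset.forall_mem_image, inner_orthogonalProjectionOnto,
      inner_add_right, add_assoc]

/-! ### Aggregates -/

theorem inner_of_mem_levelUnion {v x : E} {c : ℝ} (hx : x ∈ levelUnion P v c) : ⟪v, x⟫ = c := by
  obtain ⟨G, ⟨-, hG⟩, hxG⟩ := hx
  exact hG x hxG

/-- Faces of `F` are faces of `P`, and a face of `P` meets `F` in a face of `F` or in the empty set.
This lets the recursion pass to facets. -/
theorem levelUnion_inter_face (hF : IsFace P F) (v : E) (c : ℝ) :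
    levelUnion P v c ∩ F = levelUnion F v c := by
  ext x
  constructor
  · rintro ⟨⟨G, ⟨hG, hGc⟩, hxG⟩, hxF⟩
    exact ⟨G ∩ F, ⟨hF.inter hG ⟨x, hxG, hxF⟩, fun y hy => hGc y hy.1⟩, hxG, hxF⟩
  · rintro ⟨G, ⟨hG, hGc⟩, hxG⟩
    exact ⟨⟨G, ⟨hF.trans hG, hGc⟩, hxG⟩, hG.subset hxG⟩

/-- On `F` the forms given by `v` and by its projection differ by the constant `⟪v, basePoint F⟫`,
which shifts the level. -/
theorem translate_levelUnion [FiniteDimensional ℝ E] (v : E) (c : ℝ) :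
    translate F (levelUnion F v c) = levelUnion (translate F F)
      ((vectorSpan ℝ F).orthogonalProjectionOnto v) (c - ⟪v, basePoint F⟫) := by
  ext y
  constructor
  · rintro ⟨G, ⟨hG, hGc⟩, hy⟩
    refine ⟨translate F G, ⟨hG.translateFace, fun z hz => ?_⟩, hy⟩
    rw [inner_orthogonalProjectionOnto, ← hGc _ hz, inner_add_right]
    ring
  · rintro ⟨G, ⟨hG, hGc⟩, hy⟩
    refine ⟨embed F '' G, ⟨hG.embed_image, ?_⟩, ⟨y, hy, rfl⟩⟩
    rintro _ ⟨z, hz, rfl⟩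
    have := hGc z hz
    rw [inner_orthogonalProjectionOnto] at this
    rw [embed_apply, inner_add_right, this]
    ring

theorem setDim_le [FiniteDimensional ℝ E] (S : Set E) : setDim S ≤ Module.finrank ℝ E :=
  Submodule.finrank_le _

theorem bddAbove_setDim [FiniteDimensional ℝ E] (V : Set E) :
    BddAbove {d | ∃ G, IsFace P G ∧ G ⊆ V ∧ d = setDim G} := by
  refine ⟨Module.finrank ℝ E, ?_⟩
  rintro _ ⟨G, -, -, rfl⟩
  exact setDim_le G

theorem aggDim_le [FiniteDimensional ℝ E] (V : Set E) : aggDim P V ≤ Module.finrank ℝ E := by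
  refine csSup_le' ?_
  rintro _ ⟨G, -, -, rfl⟩
  exact setDim_le G

theorem aggDim_translate_le [FiniteDimensional ℝ E] (hF : IsFace P F) (V : Set E) :
    aggDim (translate F F) (translate F (V ∩ F)) ≤ aggDim P V := by
  refine csSup_le' ?_
  rintro _ ⟨G, hG, hGV, rfl⟩
  refine le_csSup (bddAbove_setDim V) ⟨embed F '' G, hF.trans hG.embed_image, ?_,
    (setDim_embed_image G).symm⟩
  rintro _ ⟨y, hy, rfl⟩
  exact (hGV hy).1

theorem aggDim_self [FiniteDimensional ℝ E] (hP : IsPolytope P) : aggDim P P = setDim P := by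
  refine le_antisymm (csSup_le' ?_)
    (le_csSup (bddAbove_setDim P) ⟨P, IsFace.refl hP, subset_rfl, rfl⟩)
  rintro _ ⟨G, hG, -, rfl⟩
  exact Submodule.finrank_mono (vectorSpan_mono ℝ hG.subset)

theorem levelUnion_zero (hP : IsPolytope P) : levelUnion P 0 0 = P := by
  refine Set.Subset.antisymm ?_ fun x hx => ⟨P, ⟨IsFace.refl hP, by simp⟩, hx⟩
  rintro x ⟨G, ⟨hG, -⟩, hx⟩
  exact hG.subset hx

theorem levelUnion_zero_of_ne {c : ℝ} (hc : c ≠ 0) : levelUnion P 0 c = ∅ := by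
  rw [Set.eq_empty_iff_forall_notMem]
  intro x hx
  have := inner_of_mem_levelUnion hx
  rw [inner_zero_left] at this
  exact hc this.symm

/-- The values of `⟪v, ·⟫` on the aggregates of `P`. -/
def levels (P : Set E) (v : E) : Set ℝ := {c | (levelUnion P v c).Nonempty}

theorem finite_levels (hP : IsPolytope P) (v : E) : (levels P v).Finite := by
  refine (hP.finite_faces.image (value v)).subset ?_
  rintro c ⟨x, G, ⟨hG, hGc⟩, hx⟩
  refine ⟨G, hG, ?_⟩
  have hne : G.Nonempty := ⟨x, hx⟩
  rw [value, dif_pos hne]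
  exact hGc _ hne.some_mem

theorem value_levelUnion {v : E} {c : ℝ} (hc : c ∈ levels P v) : value v (levelUnion P v c) = c := by
  have hc : (levelUnion P v c).Nonempty := hc
  rw [value, dif_pos hc]
  exact inner_of_mem_levelUnion hc.some_mem

theorem aggregates_eq_image (P : Set E) (v : E) :
    aggregates P v = (levelUnion P v) '' levels P v := by
  ext V
  constructor
  · rintro ⟨hV, c, rfl⟩; exact ⟨c, hV, rfl⟩
  · rintro ⟨c, hc, rfl⟩; exact ⟨hc, c, rfl⟩

/-- Aggregates can thus be indexed by their values, which translate simply when passing to a facet.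
-/
theorem injOn_levelUnion (P : Set E) (v : E) : Set.InjOn (levelUnion P v) (levels P v) :=
  fun c hc d hd h => by rw [← value_levelUnion hc, ← value_levelUnion hd, h]

end Geometry

/-! ### The recursion for the coefficients -/

section Coefficients

variable {E : Type u} [NormedAddCommGroup E] [InnerProductSpace ℝ E] [FiniteDimensional ℝ E]
  [MeasurableSpace E] [BorelSpace E] {P : Set E}

theorem aggCoeff_empty (n : ℕ) (v : E) (k : ℕ) : aggCoeff n E P v ∅ k = 0 := by
  cases n <;> simp [aggCoeff]

theorem aggCoeff_of_aggDim_lt (n : ℕ) (v : E) {V : Set E} {k : ℕ} (h : aggDim P V < k) :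
    aggCoeff n E P v V k = 0 := by
  cases n <;> simp [aggCoeff, h]

theorem aggCoeff_zero_direction {n : ℕ} (hP : IsPolytope P) (hd : setDim P = n) (k : ℕ) :
    aggCoeff n E P 0 P k = if k = n then (volume P).toReal else 0 := by
  have hne : P ≠ ∅ := hP.1.ne_empty
  have ha := aggDim_self hP
  cases n with
  | zero =>
    simp only [aggCoeff, hne, false_or, ha, hd]
    by_cases hk : k = 0
    · simp [hk]
    · simp [hk]
  | succ n =>
    simp only [aggCoeff, hne, false_or, ha, hd]
    by_cases hk : k = n + 1
    · simp [hk]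
    · simp [hk]

/-- The cutoff cases of the definition need no separate treatment: if `V` is empty or `k` exceeds
its dimension, the same holds for `V ∩ F` on each facet, and every term vanishes. -/
theorem aggCoeff_succ {n : ℕ} {v : E} (hv : v ≠ 0) (V : Set E) (k : ℕ) :
    aggCoeff (n + 1) E P v V k = -∑ᶠ F ∈ facets P, ⟪innerNormal P F, v⟫ / ‖v‖ ^ 2 *
      aggCoeff n (vectorSpan ℝ F) (translate F F)
        ((vectorSpan ℝ F).orthogonalProjectionOnto v) (translate F (V ∩ F)) k := by
  rw [aggCoeff]
  split_ifs with h
  · symm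
    rw [neg_eq_zero]
    refine finsum_mem_eq_zero_of_forall_eq_zero fun F hF => ?_
    rcases h with rfl | h
    · have : translate F (∅ ∩ F) = ∅ := by
        ext y; simp [mem_translate]
      rw [this, aggCoeff_empty, mul_zero]
    · rw [aggCoeff_of_aggDim_lt _ _ ((aggDim_translate_le hF.1 V).trans_lt h), mul_zero]
  · rfl

end Coefficients

/-! ### Integration over cones -/

section Cones

variable {E L : Type*} [NormedAddCommGroup E] [InnerProductSpace ℝ E] [FiniteDimensional ℝ E]
  [MeasurableSpace E] [BorelSpace E]
  [NormedAddCommGroup L] [InnerProductSpace ℝ L] [FiniteDimensional ℝ L]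
  [MeasurableSpace L] [BorelSpace L]

/-- Orthogonal coordinates adapted to a hyperplane and a unit normal vector. -/
def orthogonalCoordinates (ι : L →ₗᵢ[ℝ] E) (ν : E) (hν : ‖ν‖ = 1) (hort : ∀ w, ⟪ν, ι w⟫ = 0) :
    WithLp 2 (L × ℝ) →ₗᵢ[ℝ] E where
  toFun x := ι x.fst + x.snd • ν
  map_add' x y := by simp [add_smul]; abel
  map_smul' r x := by simp [smul_smul]
  norm_map' x := by
    change ‖ι x.fst + x.snd • ν‖ = ‖x‖
    rw [← sq_eq_sq₀ (norm_nonneg _) (norm_nonneg _), WithLp.prod_norm_sq_eq_of_L2, pow_two,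
      norm_add_sq_eq_norm_sq_add_norm_sq_real
        (by rw [inner_smul_right, real_inner_comm, hort, mul_zero]), ι.norm_map, norm_smul, hν]
    simp [pow_two]

theorem integral_eq_integral_slices (ι : L →ₗᵢ[ℝ] E) {ν : E} (hν : ‖ν‖ = 1)
    (hort : ∀ w, ⟪ν, ι w⟫ = 0) (hfin : Module.finrank ℝ L + 1 = Module.finrank ℝ E)
    {G : E → ℝ} (hG : Integrable G) : ∫ z, G z = ∫ s : ℝ, ∫ w : L, G (ι w + s • ν) := by
  have hf : Module.finrank ℝ (WithLp 2 (L × ℝ)) = Module.finrank ℝ E := by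
    rw [(WithLp.linearEquiv 2 ℝ (L × ℝ)).finrank_eq, Module.finrank_prod, Module.finrank_self, hfin]
  let T := (orthogonalCoordinates ι ν hν hort).toLinearIsometryEquiv hf
  let e : L × ℝ ≃ᵐ E := (MeasurableEquiv.toLp 2 (L × ℝ)).trans T.toMeasurableEquiv
  have he : MeasurePreserving e volume volume :=
    (WithLp.volume_preserving_toLp L ℝ).trans T.measurePreserving
  have hval : ∀ x : L × ℝ, e x = ι x.1 + x.2 • ν := fun x => rfl
  have hint : Integrable (fun x : L × ℝ => G (e x)) (volume.prod volume) :=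
    (he.integrable_comp_emb e.measurableEmbedding).2 hG
  rw [← he.integral_comp e.measurableEmbedding, Measure.volume_eq_prod, integral_prod_symm _ hint]
  simp only [hval]

/-- The slice at `⟪b, z⟫ = t` lies at distance `t / ‖b‖` from the origin, whence the factor `‖b‖⁻¹`.
It is parametrized by scaling the slice at height 1 by `t`, whence the power of `t`. -/
theorem integral_eq_integral_cone (ι : L →ₗᵢ[ℝ] E) {b p : E} (hb : b ≠ 0)
    (hort : ∀ w, ⟪b, ι w⟫ = 0) (hfin : Module.finrank ℝ L + 1 = Module.finrank ℝ E)
    (hp : ⟪b, p⟫ = 1) {G : E → ℝ} (hG : Integrable G)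
    (hG0 : ∀ z, G z ≠ 0 → 0 < ⟪b, z⟫ ∧ ⟪b, z⟫ ≤ 1) :
    ∫ z, G z = ‖b‖⁻¹ * ∫ t in Set.Ioc (0 : ℝ) 1,
      t ^ Module.finrank ℝ L * ∫ w : L, G (t • (ι w + p)) := by
  have hb' : 0 < ‖b‖ := norm_pos_iff.2 hb
  have hbb : ⟪b, b⟫ = ‖b‖ ^ 2 := real_inner_self_eq_norm_sq b
  set ν := ‖b‖⁻¹ • b with hν
  have hνn : ‖ν‖ = 1 := by rw [hν, norm_smul, norm_inv, norm_norm, inv_mul_cancel₀ hb'.ne']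
  have hνo : ∀ w, ⟪ν, ι w⟫ = 0 := fun w => by rw [hν, real_inner_smul_left, hort, mul_zero]
  have hrange : LinearMap.range ι.toLinearMap = (ℝ ∙ b)ᗮ := by
    refine Submodule.eq_of_le_of_finrank_eq ?_ ?_
    · rintro _ ⟨w, rfl⟩
      exact Submodule.mem_orthogonal_singleton_iff_inner_right.2 (hort w)
    · rw [LinearMap.finrank_range_of_inj ι.injective]
      have := finrank_orthogonal_singleton hb
      omega
  -- The foot of the perpendicular from 0 to the hyperplane `⟪b, ·⟫ = 1` is `(‖b‖ ^ 2)⁻¹ • b`; `w₀`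
  -- is the offset of `p` from it.
  obtain ⟨w₀, hw₀⟩ : ∃ w, ι w = p - (‖b‖ ^ 2)⁻¹ • b := by
    have : p - (‖b‖ ^ 2)⁻¹ • b ∈ LinearMap.range ι.toLinearMap := by
      rw [hrange, Submodule.mem_orthogonal_singleton_iff_inner_right, inner_sub_right,
        inner_smul_right, hp, hbb, inv_mul_cancel₀ (by positivity), sub_self]
    exact this
  have hscale := Measure.integral_comp_div (fun s : ℝ => ∫ w : L, G (ι w + s • ν)) ‖b‖
  rw [abs_of_pos hb', smul_eq_mul] at hscale
  rw [integral_eq_integral_slices ι hνn hνo hfin hG, eq_inv_mul_iff_mul_eq₀ hb'.ne', ← hscale]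
  have hin : ∀ (t : ℝ) (w : L), ⟪b, ι w + (t / ‖b‖) • ν⟫ = t := by
    intro t w
    rw [inner_add_right, hort, hν, inner_smul_right, inner_smul_right, hbb]
    field_simp
    ring
  rw [← setIntegral_eq_integral_of_forall_compl_eq_zero (s := Set.Ioc (0 : ℝ) 1)]
  · refine setIntegral_congr_fun measurableSet_Ioc fun t ht => ?_
    have ht0 : 0 < t := ht.1
    have e1 : ∀ w, t • (ι w + p) = ι (t • (w + w₀)) + (t / ‖b‖) • ν := by
      intro w
      rw [map_smul, map_add, hw₀, hν, smul_smul]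
      have : t / ‖b‖ * ‖b‖⁻¹ = t * (‖b‖ ^ 2)⁻¹ := by field_simp
      rw [this]
      module
    simp only [e1]
    rw [integral_add_right_eq_self (fun w => G (ι (t • w) + (t / ‖b‖) • ν)) w₀,
      Measure.integral_comp_smul volume (fun w => G (ι w + (t / ‖b‖) • ν)) t,
      abs_of_pos (by positivity), smul_eq_mul, mul_inv_cancel_left₀ (by positivity)]
  · intro t ht
    refine integral_eq_zero_of_ae (Filter.Eventually.of_forall fun w => ?_)
    by_contra hne
    have := hG0 _ hne
    rw [hin] at this
    exact ht this

/-- Integration in polar coordinates over a cone with apex `0` and base `S` in the hyperplane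
`⟪b, ·⟫ = 1`, for a function whose radial primitive is known. -/
theorem setIntegral_cone (ι : L →ₗᵢ[ℝ] E) {b p : E} (hb : b ≠ 0)
    (hort : ∀ w, ⟪b, ι w⟫ = 0) (hfin : Module.finrank ℝ L + 1 = Module.finrank ℝ E)
    (hp : ⟪b, p⟫ = 1) {K S : Set E} (hK : MeasurableSet K) (hKb : Bornology.IsBounded K)
    (hKpos : ∀ z ∈ K, 0 < ⟪b, z⟫ ∧ ⟪b, z⟫ ≤ 1) (hS : IsCompact S)
    (hKS : ∀ t : ℝ, 0 < t → t ≤ 1 → ∀ w, t • (ι w + p) ∈ K ↔ ι w + p ∈ S)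
    {φ ψ : E → ℝ} (hψ : Continuous ψ)
    (hd : ∀ (x : E) (t : ℝ), HasDerivAt (fun t : ℝ => t ^ (Module.finrank ℝ L + 1) * φ (t • x))
      (t ^ Module.finrank ℝ L * ψ (t • x)) t) :
    ∫ z in K, ψ z = ‖b‖⁻¹ * ∫ w in {w | ι w + p ∈ S}, φ (ι w + p) := by
  set m := Module.finrank ℝ L
  have hcS : IsCompact {w : L | ι w + p ∈ S} :=
    ((Homeomorph.addRight p).isClosedEmbedding.comp ι.isometry.isClosedEmbedding).isCompact_preimage
      hS
  have hmS : MeasurableSet {w : L | ι w + p ∈ S} := hcS.isClosed.measurableSet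
  have hint : Integrable (K.indicator ψ) := by
    rw [integrable_indicator_iff hK]
    exact (hψ.continuousOn.integrableOn_compact hKb.isCompact_closure).mono_set subset_closure
  rw [← integral_indicator hK, integral_eq_integral_cone ι hb hort hfin hp hint]
  · congr 1
    have e1 : ∀ t ∈ Set.Ioc (0 : ℝ) 1, t ^ m * ∫ w : L, K.indicator ψ (t • (ι w + p)) =
        ∫ w in {w : L | ι w + p ∈ S}, t ^ m * ψ (t • (ι w + p)) := by
      intro t ht
      rw [integral_const_mul, ← integral_indicator hmS]
      congr 2
      ext w
      have := hKS t ht.1 ht.2 w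
      by_cases h : ι w + p ∈ S
      · rw [Set.indicator_of_mem (this.2 h), Set.indicator_of_mem (by exact h)]
      · rw [Set.indicator_of_notMem (mt this.1 h), Set.indicator_of_notMem (by exact h)]
    -- With the radial integral inside, `hd` integrates it exactly; the primitive vanishes at `t =
    -- 0`, so only `φ` on the base remains.
    rw [setIntegral_congr_fun measurableSet_Ioc e1, integral_integral_swap]
    · refine setIntegral_congr_fun hmS fun w _ => ?_
      change ∫ t in Set.Ioc (0 : ℝ) 1, t ^ m * ψ (t • (ι w + p)) = _
      rw [← intervalIntegral.integral_of_le zero_le_one,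
        intervalIntegral.integral_eq_sub_of_hasDerivAt (fun t _ => hd (ι w + p) t)]
      · simp
      · exact Continuous.intervalIntegrable (by fun_prop) _ _
    · rw [Measure.prod_restrict]
      have hc : Continuous (Function.uncurry fun (t : ℝ) (w : L) => t ^ m * ψ (t • (ι w + p))) := by
        unfold Function.uncurry
        have := ι.continuous
        fun_prop
      exact (hc.continuousOn.integrableOn_compact (isCompact_Icc.prod hcS)).mono_set
        (Set.prod_mono Set.Ioc_subset_Icc_self subset_rfl)
  · intro z hz
    exact hKpos z (Set.mem_of_indicator_ne_zero hz)

end Cones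

/-! ### The divergence theorem by decomposition into cones -/

section FacetFormula

variable {E : Type u} [NormedAddCommGroup E] [InnerProductSpace ℝ E] [FiniteDimensional ℝ E]
  {P : Set E}

/-- This is the distance from `a` to the facet, matching the Jacobian factor of the cone formula.
Orthogonality to a span of codimension one makes the normal a multiple `r • b`; pointing inward
forces `r ≤ 0`, and unit length gives its size. -/
theorem inner_innerNormal_apex {a b : E} (hb : b ≠ 0) (ha : a ∈ P)
    (hP : ∀ x ∈ P, ⟪b, x - a⟫ ≤ 1) (hne : (polarFace P a b).Nonempty)
    (hd : setDim (polarFace P a b) + 1 = Module.finrank ℝ E) :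
    ⟪innerNormal P (polarFace P a b), a - basePoint (polarFace P a b)⟫ = ‖b‖⁻¹ := by
  have hb' : 0 < ‖b‖ := norm_pos_iff.2 hb
  have hex : ∃ v : E, ‖v‖ = 1 ∧ (∀ w ∈ vectorSpan ℝ (polarFace P a b), ⟪v, w⟫ = 0) ∧
      ∀ x ∈ P, ∀ y ∈ polarFace P a b, ⟪v, y⟫ ≤ ⟪v, x⟫ := by
    refine ⟨-(‖b‖⁻¹ • b), ?_, fun w hw => ?_, fun x hx y hy => ?_⟩
    · rw [norm_neg, norm_smul, norm_inv, norm_norm, inv_mul_cancel₀ hb'.ne']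
    · rw [inner_neg_left, real_inner_smul_left, polarFace_inner_vectorSpan hw]; simp
    · have h1 := hP x hx
      have h2 := hy.2
      rw [inner_sub_right] at h1 h2
      rw [inner_neg_left, inner_neg_left, real_inner_smul_left, real_inner_smul_left]
      have : ‖b‖⁻¹ * ⟪b, x⟫ ≤ ‖b‖⁻¹ * ⟪b, y⟫ :=
        mul_le_mul_of_nonneg_left (by linarith) (by positivity)
      linarith
  set F := polarFace P a b with hF
  have hspec := hex.choose_spec
  have hin : innerNormal P F = hex.choose := by rw [innerNormal, dif_pos hex]
  rw [← hin] at hspec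
  obtain ⟨hnorm, hort, hle⟩ := hspec
  have hmem : innerNormal P F ∈ (ℝ ∙ b) := by
    rw [← Submodule.orthogonal_orthogonal (ℝ ∙ b), ← vectorSpan_polarFace hb hd,
      Submodule.mem_orthogonal]
    intro w hw
    rw [real_inner_comm]
    exact hort w hw
  obtain ⟨r, hr⟩ := Submodule.mem_span_singleton.1 hmem
  have hm := basePoint_mem hne
  have h1 := hle a ha _ hm
  have h2 := hm.2
  rw [← hr] at hnorm h1 ⊢
  have h3 : ⟪r • b, a - basePoint F⟫ = -r := by
    rw [← neg_sub, inner_neg_right, real_inner_smul_left, h2, mul_one]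
  rw [h3]
  rw [inner_sub_right] at h3
  have hr0 : r ≤ 0 := by linarith
  rw [norm_smul, Real.norm_eq_abs, abs_of_nonpos hr0] at hnorm
  exact eq_inv_of_mul_eq_one_left hnorm

theorem IsPolytope.finite_facets (hP : IsPolytope P) : (facets P).Finite :=
  hP.finite_faces.subset fun _ hF => hF.1

theorem IsPolytope.interior_nonempty (hP : IsPolytope P) (hd : setDim P = Module.finrank ℝ E) :
    (interior P).Nonempty := by
  rw [hP.convex.interior_nonempty_iff_affineSpan_eq_top,
    ← AffineSubspace.direction_eq_top_iff_of_nonempty ((affineSpan_nonempty ℝ).2 hP.1),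
    direction_affineSpan]
  exact Submodule.eq_top_of_finrank_eq hd

variable [MeasurableSpace E] [BorelSpace E]

theorem volume_orthogonal_singleton {b : E} (hb : b ≠ 0) :
    volume ((ℝ ∙ b)ᗮ : Set E) = 0 := by
  refine Measure.addHaar_submodule volume _ fun h => hb ?_
  have : b ∈ (ℝ ∙ b)ᗮ := h ▸ Submodule.mem_top
  exact inner_self_eq_zero.1 (Submodule.mem_orthogonal_singleton_iff_inner_right.1 this)

/-- The cone with apex `0` over the polar face of `b`. -/
def polarCone (B : Finset E) (b : E) : Set E :=
  {z | 0 < ⟪b, z⟫ ∧ ⟪b, z⟫ ≤ 1 ∧ ∀ b' ∈ B, ⟪b', z⟫ ≤ ⟪b, z⟫}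

theorem measurableSet_polarCone (B : Finset E) (b : E) : MeasurableSet (polarCone B b) := by
  have : polarCone B b = {z | 0 < ⟪b, z⟫} ∩ ({z | ⟪b, z⟫ ≤ 1} ∩
      ⋂ b' ∈ B, {z | ⟪b', z⟫ ≤ ⟪b, z⟫}) := by
    ext z; simp [polarCone]
  rw [this]
  refine (isOpen_lt (by fun_prop) (by fun_prop)).measurableSet.inter (IsClosed.measurableSet ?_)
  exact (isClosed_le (by fun_prop) (by fun_prop)).inter
    (isClosed_biInter fun b' _ => isClosed_le (by fun_prop) (by fun_prop))

/-- On the overlap the forms of `b` and `b'` agree, so it lies in a hyperplane. -/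
theorem aedisjoint_polarCone {B : Finset E} {b b' : E} (hb : b ∈ B) (hb' : b' ∈ B) (h : b ≠ b') :
    AEDisjoint volume (polarCone B b) (polarCone B b') := by
  refine measure_mono_null (fun z hz => ?_) (volume_orthogonal_singleton (sub_ne_zero.2 h))
  refine Submodule.mem_orthogonal_singleton_iff_inner_right.2 ?_
  rw [inner_sub_left, sub_eq_zero]
  exact le_antisymm (hz.2.2.2 b hb) (hz.1.2.2 b' hb')

/-- The cone lies in the linear span of the polar face shifted by `-a`. Were this span everything,
the polar face would have codimension one and be a facet. -/
theorem volume_polarCone_of_notMem_facets {B : Finset E} {a b : E} (hB : 0 ∉ B)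
    (hP : P = {x | ∀ b ∈ B, ⟪b, x - a⟫ ≤ 1}) (hc : Convex ℝ P)
    (hdim : setDim P = Module.finrank ℝ E) (hpos : 0 < Module.finrank ℝ E) (hb : b ∈ B)
    (hF : polarFace P a b ∉ facets P) : volume (polarCone B b) = 0 := by
  have hb0 : b ≠ 0 := fun h => hB (h ▸ hb)
  have : Nontrivial E := Module.nontrivial_of_finrank_pos hpos
  refine measure_mono_null (t := (Submodule.span ℝ {z | z + a ∈ polarFace P a b} : Set E))
    (fun z hz => ?_) (Measure.addHaar_submodule volume _ fun htop => hF ?_)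
  · obtain ⟨h0, -, hz⟩ := hz
    have : (⟪b, z⟫)⁻¹ • z ∈ Submodule.span ℝ {z | z + a ∈ polarFace P a b} := by
      refine Submodule.subset_span ⟨?_, ?_⟩
      · rw [hP]
        intro b' hb'
        rw [add_sub_cancel_right, inner_smul_right, inv_mul_le_one₀ h0]
        exact hz b' hb'
      · rw [add_sub_cancel_right, inner_smul_right, inv_mul_cancel₀ h0.ne']
    have h2 := Submodule.smul_mem _ ⟪b, z⟫ this
    rwa [smul_inv_smul₀ h0.ne'] at h2
  · obtain ⟨z₀, hz₀⟩ : {z | z + a ∈ polarFace P a b}.Nonempty := by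
      by_contra hne
      rw [Set.not_nonempty_iff_eq_empty] at hne
      rw [hne, Submodule.span_empty] at htop
      exact bot_ne_top htop
    have hz₀ : z₀ + a ∈ polarFace P a b := hz₀
    have hle : Submodule.span ℝ {z | z + a ∈ polarFace P a b} ≤
        vectorSpan ℝ (polarFace P a b) ⊔ (ℝ ∙ z₀) := by
      rw [Submodule.span_le]
      intro z hz
      have h1 : (z + a) - (z₀ + a) ∈ vectorSpan ℝ (polarFace P a b) :=
        vsub_mem_vectorSpan ℝ hz hz₀
      have h2 : z = ((z + a) - (z₀ + a)) + z₀ := by abel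
      rw [h2]
      exact Submodule.add_mem_sup h1 (Submodule.mem_span_singleton_self z₀)
    rw [htop] at hle
    have h1 : Module.finrank ℝ E ≤ setDim (polarFace P a b) + 1 := by
      calc Module.finrank ℝ E = Module.finrank ℝ (⊤ : Submodule ℝ E) := (finrank_top ℝ E).symm
        _ ≤ _ := Submodule.finrank_mono hle
        _ ≤ _ := Submodule.finrank_add_le_finrank_add_finrank _ _
        _ ≤ _ := Nat.add_le_add_left (finrank_span_le_card {z₀} |>.trans (by simp)) _
    have h2 := setDim_polarFace_lt (P := P) (a := a) hb0
    exact ⟨isFace_polarFace hP hc hb ⟨_, hz₀⟩, by omega⟩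

theorem setIntegral_polarCone {B : Finset E} {a b : E} (hB : 0 ∉ B)
    (hPB : P = {x | ∀ b ∈ B, ⟪b, x - a⟫ ≤ 1}) (hP : IsPolytope P)
    (hdim : setDim P = Module.finrank ℝ E) {m : ℕ} (hm : m + 1 = Module.finrank ℝ E) (hb : b ∈ B)
    (hF : polarFace P a b ∈ facets P) {φ ψ : E → ℝ} (hψ : Continuous ψ)
    (hd : ∀ (x : E) (t : ℝ), HasDerivAt (fun t : ℝ => t ^ (m + 1) * φ (t • x))
      (t ^ m * ψ (t • x)) t) :
    ∫ z in polarCone B b, ψ z =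
      ⟪innerNormal P (polarFace P a b), a - basePoint (polarFace P a b)⟫ *
        ∫ y in translate (polarFace P a b) (polarFace P a b),
          φ ((y : E) + basePoint (polarFace P a b) - a) := by
  have hb0 : b ≠ 0 := fun h => hB (h ▸ hb)
  have hdF : setDim (polarFace P a b) + 1 = Module.finrank ℝ E := by rw [hF.2, hdim]
  have haP : a ∈ P := by rw [hPB]; intro b _; simp
  have hle : ∀ x ∈ P, ⟪b, x - a⟫ ≤ 1 := by
    intro x hx; rw [hPB] at hx; exact hx b hb
  rw [inner_innerNormal_apex hb0 haP hle hF.1.1 hdF]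
  have hcF := (hF.1.isPolytope hP).isCompact
  have hbm := (basePoint_mem hF.1.1).2
  set F := polarFace P a b with hFdef
  have hbw : ∀ w : vectorSpan ℝ F, ⟪b, (w : E)⟫ = 0 := fun w => polarFace_inner_vectorSpan w.2
  have hfr : Module.finrank ℝ (vectorSpan ℝ F) = m := by
    unfold setDim at hdF; omega
  have hbz : ∀ w : vectorSpan ℝ F, ⟪b, (w : E) + (basePoint F - a)⟫ = 1 := by
    intro w; rw [inner_add_right, hbw, hbm, zero_add]
  have hcS : IsCompact ((fun z => z + a) ⁻¹' F) :=
    (Homeomorph.addRight a).isClosedEmbedding.isCompact_preimage hcF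
  have hbd : Bornology.IsBounded (polarCone B b) := by
    have h1 : IsCompact ((fun z => z + a) ⁻¹' P) :=
      (Homeomorph.addRight a).isClosedEmbedding.isCompact_preimage hP.isCompact
    refine h1.isBounded.subset fun z hz => ?_
    change z + a ∈ P
    rw [hPB]
    intro b' hb'
    rw [add_sub_cancel_right]
    exact (hz.2.2 b' hb').trans hz.2.1
  have := setIntegral_cone (vectorSpan ℝ F).subtypeₗᵢ hb0 hbw (p := basePoint F - a)
    (by omega) hbm (measurableSet_polarCone B b) hbd (fun z hz => ⟨hz.1, hz.2.1⟩) hcS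
    (by
      intro t ht0 ht1 w
      change t • ((w : E) + (basePoint F - a)) ∈ polarCone B b ↔
        (w : E) + (basePoint F - a) + a ∈ polarFace P a b
      have hw := hbz w
      set x := (w : E) + (basePoint F - a)
      simp only [polarCone, polarFace, Set.mem_ofPred_eq, add_sub_cancel_right, inner_smul_right,
        hw, mul_one, ht0, ht1, true_and, and_true]
      rw [hPB]
      simp only [Set.mem_ofPred_eq, add_sub_cancel_right]
      exact forall₂_congr fun b' _ => by rw [mul_le_iff_le_one_right ht0])
    hψ (φ := φ) (by rw [hfr]; exact hd)
  rw [this]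
  have hset : {w : vectorSpan ℝ F | (vectorSpan ℝ F).subtypeₗᵢ w + (basePoint F - a) ∈
      (fun z => z + a) ⁻¹' F} = translate F F := by
    ext w
    change (w : E) + (basePoint F - a) + a ∈ F ↔ (w : E) + basePoint F ∈ F
    rw [add_assoc, sub_add_cancel]
  rw [hset]
  congr 2
  ext w
  change φ ((w : E) + (basePoint F - a)) = _
  rw [add_sub_assoc]

/-- Up to a null set, `P - a` is divided according to which `b ∈ B` maximizes `⟪b, z⟫`; the part
belonging to `b` is the cone over its polar face. -/
theorem setIntegral_eq_sum_facets_of_apex (hP : IsPolytope P)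
    (hdim : setDim P = Module.finrank ℝ E) {m : ℕ} (hm : m + 1 = Module.finrank ℝ E) {a : E}
    (ha : a ∈ interior P) {φ ψ : E → ℝ} (hψ : Continuous ψ)
    (hd : ∀ (x : E) (t : ℝ), HasDerivAt (fun t : ℝ => t ^ (m + 1) * φ (t • x))
      (t ^ m * ψ (t • x)) t) :
    ∫ x in P, ψ (x - a) = ∑ᶠ F ∈ facets P, ⟪innerNormal P F, a - basePoint F⟫ *
      ∫ y in translate F F, φ ((y : E) + basePoint F - a) := by
  classical
  obtain ⟨B, hB, hPB⟩ := exists_polar hP ha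
  have : Nontrivial E := Module.nontrivial_of_finrank_pos (R := ℝ) (by omega)
  have hmp := measurePreserving_add_right (volume : Measure E) a
  have hcP : IsCompact ((fun z => z + a) ⁻¹' P) :=
    (Homeomorph.addRight a).isClosedEmbedding.isCompact_preimage hP.isCompact
  have hshift : ∫ x in P, ψ (x - a) = ∫ z in (fun z => z + a) ⁻¹' P, ψ z := by
    rw [← hmp.setIntegral_preimage_emb (measurableEmbedding_addRight a)]
    simp
  have hsub : ∀ b, polarCone B b ⊆ (fun z => z + a) ⁻¹' P := by
    intro b z hz
    change z + a ∈ P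
    rw [hPB]
    intro b' hb'
    rw [add_sub_cancel_right]
    exact (hz.2.2 b' hb').trans hz.2.1
  have hcover : (fun z => z + a) ⁻¹' P ⊆ (⋃ b : B, polarCone B b) ∪ {0} := by
    intro z hz
    have hz : z + a ∈ P := hz
    rw [hPB] at hz
    have hz : ∀ b ∈ B, ⟪b, z⟫ ≤ 1 := fun b hb => by simpa using hz b hb
    by_cases hz0 : z = 0
    · exact Or.inr hz0
    left
    -- Otherwise the whole ray through `z` would stay in `P - a`, against boundedness; its point of
    -- norm `R + 1` is the contradiction.
    have hex : ∃ b ∈ B, 0 < ⟪b, z⟫ := by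
      by_contra hno
      push Not at hno
      obtain ⟨R, hR⟩ := hcP.isBounded.exists_norm_le
      have hpos : 0 < ‖z‖ := norm_pos_iff.2 hz0
      have hR0 : 0 ≤ R := (norm_nonneg _).trans (hR 0 (by
        change (0 : E) + a ∈ P; rw [zero_add]; exact interior_subset ha))
      have h1 := hR (((R + 1) / ‖z‖) • z) (by
        change _ + a ∈ P
        rw [hPB]
        intro b hb
        rw [add_sub_cancel_right, inner_smul_right]
        have := mul_nonpos_of_nonneg_of_nonpos (show 0 ≤ (R + 1) / ‖z‖ by positivity) (hno b hb)
        linarith)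
      rw [norm_smul, Real.norm_of_nonneg (by positivity), div_mul_cancel₀ _ hpos.ne'] at h1
      linarith
    obtain ⟨b₀, hb₀, hb₀z⟩ := hex
    obtain ⟨b, hb, hmax⟩ := B.exists_max_image (fun b => ⟪b, z⟫) ⟨b₀, hb₀⟩
    exact Set.mem_iUnion.2 ⟨⟨b, hb⟩, hb₀z.trans_le (hmax b₀ hb₀), hz b hb, hmax⟩
  have hae : ((fun z => z + a) ⁻¹' P : Set E) =ᵐ[volume] ⋃ b : B, polarCone B (b : E) := by
    refine Filter.EventuallyLE.antisymm ?_
      (LE.le.eventuallyLE (Set.iUnion_subset fun b : B => hsub b))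
    exact (LE.le.eventuallyLE hcover).trans (union_ae_eq_left_of_ae_eq_empty
      (ae_eq_empty.2 (measure_singleton 0))).le
  rw [hshift, setIntegral_congr_set hae, integral_iUnion_ae (s := fun b : B => polarCone B (b : E))
    (fun b => (measurableSet_polarCone B b).nullMeasurableSet)
    (fun b b' hbb => aedisjoint_polarCone b.2 b'.2 (Subtype.coe_ne_coe.2 hbb))
    ((hψ.continuousOn.integrableOn_compact hcP).mono_set (Set.iUnion_subset fun b : B => hsub b)),
    tsum_fintype, Finset.sum_coe_sort B (fun b => ∫ z in polarCone B b, ψ z)]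
  have himg : facets P = (polarFace P a) '' (B.filter fun b => polarFace P a b ∈ facets P) := by
    ext F
    constructor
    · intro hF
      obtain ⟨b, hb, rfl⟩ := facet_eq_polarFace hB hPB hdim hF
      exact ⟨b, Finset.mem_coe.2 (Finset.mem_filter.2 ⟨hb, hF⟩), rfl⟩
    · rintro ⟨b, hb, rfl⟩
      exact (Finset.mem_filter.1 (Finset.mem_coe.1 hb)).2
  have hinj : Set.InjOn (polarFace P a) (B.filter fun b => polarFace P a b ∈ facets P) := by
    intro b hb b' hb' h
    obtain ⟨hbB, hbF⟩ := Finset.mem_filter.1 (Finset.mem_coe.1 hb)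
    exact polarFace_injective (fun h => hB (h ▸ hbB)) (by rw [hbF.2, hdim]) hbF.1.1 h.subset
  conv_rhs => rw [himg]
  rw [finsum_mem_image hinj, finsum_mem_coe_finset, Finset.sum_filter]
  refine Finset.sum_congr rfl fun b hb => ?_
  split_ifs with hF
  · exact setIntegral_polarCone hB hPB hP hdim hm hb hF hψ hd
  · exact setIntegral_measure_zero _
      (volume_polarCone_of_notMem_facets hB hPB hP.convex hdim (by omega) hb hF)

/-- The divergence theorem on a polytope, for functions of a linear form. -/
theorem setIntegral_deriv_eq_sum_facets (hP : IsPolytope P)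
    (hdim : setDim P = Module.finrank ℝ E) (hpos : 0 < Module.finrank ℝ E) (v : E) {g : ℝ → ℝ}
    (hg : ContDiff ℝ 1 g) :
    ‖v‖ ^ 2 * ∫ x in P, deriv g ⟪v, x⟫ = -∑ᶠ F ∈ facets P, ⟪innerNormal P F, v⟫ *
      ∫ y in translate F F, g ⟪v, (y : E) + basePoint F⟫ := by
  obtain ⟨m, hm⟩ : ∃ m, m + 1 = Module.finrank ℝ E := ⟨Module.finrank ℝ E - 1, by omega⟩
  have hg' : Continuous (deriv g) := hg.continuous_deriv le_rfl
  have hgc : Continuous g := hg.continuous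
  -- The divergence identity for the field `g ⟪v, x⟫ • (x - a)`: the integrand on the left is its
  -- divergence, the radial derivative required by the cone formula.
  have apex : ∀ a ∈ interior P,
      ∫ x in P, ((m + 1) * g ⟪v, x⟫ + ⟪v, x - a⟫ * deriv g ⟪v, x⟫) =
        ∑ᶠ F ∈ facets P, ⟪innerNormal P F, a - basePoint F⟫ *
          ∫ y in translate F F, g ⟪v, (y : E) + basePoint F⟫ := by
    intro a ha
    have := setIntegral_eq_sum_facets_of_apex hP hdim hm ha
      (φ := fun z => g ⟪v, z + a⟫)
      (ψ := fun z => (m + 1) * g ⟪v, z + a⟫ + ⟪v, z⟫ * deriv g ⟪v, z + a⟫) (by fun_prop) (by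
        intro x t
        have h1 : HasDerivAt (fun t : ℝ => ⟪v, t • x + a⟫) ⟪v, x⟫ t := by
          have : (fun t : ℝ => ⟪v, t • x + a⟫) = fun t : ℝ => t * ⟪v, x⟫ + ⟪v, a⟫ := by
            ext t; rw [inner_add_right, inner_smul_right]
          rw [this]
          simpa using ((hasDerivAt_id t).mul_const ⟪v, x⟫).add_const ⟪v, a⟫
        have h2 : HasDerivAt g (deriv g ⟪v, t • x + a⟫) ⟪v, t • x + a⟫ :=
          (hg.differentiable one_ne_zero).differentiableAt.hasDerivAt
        have h3 := (hasDerivAt_pow (m + 1) t).mul (h2.comp t h1)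
        refine h3.congr_deriv ?_
        simp only [Function.comp_apply, Nat.add_sub_cancel, inner_smul_right]
        push_cast
        ring)
    simpa only [sub_add_cancel] using this
  obtain ⟨I, hI⟩ : ∃ I : Set E → ℝ, ∀ F : Set E,
      ∫ y in translate F F, g ⟪v, (y : E) + basePoint F⟫ = I F := ⟨_, fun _ => rfl⟩
  simp only [hI] at apex ⊢
  obtain ⟨a, ha⟩ := hP.interior_nonempty hdim
  have cont : Continuous fun ε : ℝ => a + ε • v := by fun_prop
  have ev : ∀ᶠ ε : ℝ in nhdsWithin 0 (Set.Ioi 0), a + ε • v ∈ interior P :=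
    (cont.continuousAt.eventually (by simpa using isOpen_interior.mem_nhds ha)).filter_mono
      nhdsWithin_le_nhds
  obtain ⟨ε, hε, hε0⟩ := (ev.and self_mem_nhdsWithin).exists
  have hε0 : 0 < ε := hε0
  have hint : ∀ f : E → ℝ, Continuous f → IntegrableOn f P :=
    fun f hf => hf.continuousOn.integrableOn_compact hP.isCompact
  -- The facet integrals do not depend on the apex, so the difference of the identities at `a` and
  -- `a + ε • v` keeps only the terms linear in `ε • v`.
  have h := congrArg₂ (· - ·) (apex a ha) (apex _ hε)
  beta_reduce at h
  rw [← integral_sub (hint _ (by fun_prop)) (hint _ (by fun_prop)),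
    ← finsum_mem_sub_distrib (fun F => ⟪innerNormal P F, a - basePoint F⟫ * I F) _
      hP.finite_facets] at h
  have e1 : ∀ x, ((m + 1) * g ⟪v, x⟫ + ⟪v, x - a⟫ * deriv g ⟪v, x⟫) -
      ((m + 1) * g ⟪v, x⟫ + ⟪v, x - (a + ε • v)⟫ * deriv g ⟪v, x⟫) =
      ε * ‖v‖ ^ 2 * deriv g ⟪v, x⟫ := by
    intro x
    rw [inner_sub_right, inner_sub_right, inner_add_right, inner_smul_right,
      real_inner_self_eq_norm_sq]
    ring
  have e2 : ∀ F : Set E, ⟪innerNormal P F, a - basePoint F⟫ * I F -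
      ⟪innerNormal P F, a + ε • v - basePoint F⟫ * I F = -ε * (⟪innerNormal P F, v⟫ * I F) := by
    intro F
    rw [inner_sub_right, inner_sub_right, inner_add_right, inner_smul_right]
    ring
  simp only [e1, e2] at h
  rw [integral_const_mul, ← mul_finsum_mem (fun F => ⟪innerNormal P F, v⟫ * I F)] at h
  have : ε * (‖v‖ ^ 2 * ∫ x in P, deriv g ⟪v, x⟫) = ε * -∑ᶠ F ∈ facets P, ⟪innerNormal P F, v⟫ * I F := by linarith
  exact mul_left_cancel₀ hε0.ne' this

end FacetFormula

/-! ### Induction on the dimension -/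

theorem zero_mem_levels {E : Type u} [NormedAddCommGroup E] [InnerProductSpace ℝ E] {P : Set E}
    (hP : IsPolytope P) : (0 : ℝ) ∈ levels P 0 := by
  rw [levels, Set.mem_ofPred_eq, levelUnion_zero hP]
  exact hP.1

theorem mem_levels_of_translate {E : Type u} [NormedAddCommGroup E] [InnerProductSpace ℝ E]
    [FiniteDimensional ℝ E] {P F : Set E} (hF : IsFace P F) {v : E} {c : ℝ}
    (hc : c ∈ levels (translate F F) ((vectorSpan ℝ F).orthogonalProjectionOnto v)) :
    c + ⟪v, basePoint F⟫ ∈ levels P v := by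
  obtain ⟨y, hy⟩ := hc
  have h := translate_levelUnion (F := F) v (c + ⟪v, basePoint F⟫)
  rw [add_sub_cancel_right] at h
  rw [← h, mem_translate, ← levelUnion_inter_face hF] at hy
  exact ⟨_, hy.1⟩

/-- The space varies because a facet lives in its own direction space. Allowing any finite `T`
containing the levels lets one index set serve `P` and, after shifting, all its facets; superfluous
levels have an empty union and coefficient 0. -/
theorem setIntegral_iteratedDeriv_eq_sum_levels (n : ℕ) : ∀ (E : Type u) [NormedAddCommGroup E]
    [InnerProductSpace ℝ E] [FiniteDimensional ℝ E] [MeasurableSpace E] [BorelSpace E] (P : Set E)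
    (v : E) (f : ℝ → ℝ) (T : Finset ℝ), IsPolytope P → Module.finrank ℝ E = n → setDim P = n →
    ContDiff ℝ n f → levels P v ⊆ T → ∫ x in P, iteratedDeriv n f ⟪v, x⟫ =
      ∑ c ∈ T, ∑ k ∈ Finset.range (n + 1),
        aggCoeff n E P v (levelUnion P v c) k * iteratedDeriv k f c := by
  induction n with
  | zero =>
    intro E _ _ _ _ _ P v f T hP hfin hd _ hT
    have : Subsingleton E := Module.finrank_zero_iff.1 hfin
    obtain rfl : v = 0 := Subsingleton.elim _ _
    rw [Finset.sum_eq_single_of_mem 0 (hT (zero_mem_levels hP))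
      (fun c _ hc => by
        rw [levelUnion_zero_of_ne hc]
        simp [aggCoeff_empty]), levelUnion_zero hP]
    simp [aggCoeff_zero_direction hP hd, Measure.real]
  | succ m ih =>
    intro E _ _ _ _ _ P v f T hP hfin hd hf hT
    by_cases hv : v = 0
    · subst hv
      rw [Finset.sum_eq_single_of_mem 0 (hT (zero_mem_levels hP))
        (fun c _ hc => by
          rw [levelUnion_zero_of_ne hc]
          simp [aggCoeff_empty]), levelUnion_zero hP]
      simp [aggCoeff_zero_direction hP hd, Measure.real]
    have hfm : ContDiff ℝ m f := hf.of_le (by exact_mod_cast Nat.le_succ m)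
    have hg : ContDiff ℝ 1 (iteratedDeriv m f) := by
      rw [iteratedDeriv_eq_iterate]
      refine ContDiff.iterate_deriv' 1 m ?_
      have h : ((m + 1 : ℕ) : WithTop ℕ∞) = 1 + m := by push_cast; rw [add_comm]
      rwa [h] at hf
    have hdiv := setIntegral_deriv_eq_sum_facets hP (by rw [hd, hfin]) (by omega) v hg
    rw [← iteratedDeriv_succ] at hdiv
    have hfacet : ∀ F ∈ facets P,
        ∫ y in translate F F, iteratedDeriv m f ⟪v, (y : E) + basePoint F⟫ =
        ∑ c ∈ T, ∑ k ∈ Finset.range (m + 2),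
          aggCoeff m (vectorSpan ℝ F) (translate F F)
            ((vectorSpan ℝ F).orthogonalProjectionOnto v)
            (translate F (levelUnion P v c ∩ F)) k * iteratedDeriv k f c := by
      intro F hF
      have hFP := hF.1.isPolytope hP
      have hdF : setDim F = m := by have := hF.2; omega
      have hfr : Module.finrank ℝ (vectorSpan ℝ F) = m := hdF
      -- Translating `f` by `⟪v, basePoint F⟫` compensates for moving the facet to its direction
      -- space.
      have h := ih (vectorSpan ℝ F) (translate F F) ((vectorSpan ℝ F).orthogonalProjectionOnto v)
        (fun t => f (t + ⟪v, basePoint F⟫)) (T.image fun c => c - ⟪v, basePoint F⟫)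
        hFP.translateFace hfr (by rw [setDim_translate subset_rfl, hdF])
        (hfm.comp (contDiff_id.add contDiff_const)) (by
          intro c hc
          exact Finset.mem_coe.2 (Finset.mem_image.2
            ⟨_, hT (mem_levels_of_translate hF.1 hc), by ring⟩))
      rw [Finset.sum_image (fun c _ d _ h => by simpa using h)] at h
      simp only [iteratedDeriv_comp_add_const, sub_add_cancel, inner_orthogonalProjectionOnto,
        ← inner_add_right, ← translate_levelUnion, ← levelUnion_inter_face hF.1] at h
      rw [h]
      refine Finset.sum_congr rfl fun c _ => ?_
      -- The index `m + 1` is added only to match the range for `P`; it exceeds the dimension of the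
      -- facet.
      rw [Finset.sum_range_succ _ (m + 1), aggCoeff_of_aggDim_lt, zero_mul, add_zero]
      have := aggDim_le (P := translate F F) (translate F (levelUnion P v c ∩ F))
      omega
    rw [finsum_mem_congr rfl (fun F hF => by rw [hfacet F hF])] at hdiv
    have hv2 : ‖v‖ ^ 2 ≠ 0 := by have := norm_ne_zero_iff.2 hv; positivity
    rw [← eq_inv_mul_iff_mul_eq₀ hv2] at hdiv
    rw [hdiv]
    simp only [aggCoeff_succ hv]
    rw [finsum_mem_eq_finite_toFinset_sum _ hP.finite_facets]
    simp only [finsum_mem_eq_finite_toFinset_sum _ hP.finite_facets, Finset.mul_sum,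
      neg_mul, Finset.sum_mul, Finset.sum_neg_distrib, mul_neg]
    rw [Finset.sum_comm]
    congr 1
    refine Finset.sum_congr rfl fun c _ => ?_
    rw [Finset.sum_comm]
    refine Finset.sum_congr rfl fun k _ => Finset.sum_congr rfl fun F _ => ?_
    ring

/-! ### The polynomial form of the coefficients, and test functions -/

theorem contDiff_polynomial_eval (p : Polynomial ℝ) {n : WithTop ℕ∞} :
    ContDiff ℝ n fun z => p.eval z := by
  simpa using p.contDiff_aeval (𝕜 := ℝ) n

theorem iteratedDeriv_polynomial_eval (p : Polynomial ℝ) (i : ℕ) :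
    iteratedDeriv i (fun z => p.eval z) = fun z => (Polynomial.derivative^[i] p).eval z := by
  induction i with
  | zero => simp
  | succ i ih =>
    rw [iteratedDeriv_succ, ih, Function.iterate_succ_apply']
    ext z
    exact Polynomial.deriv _

theorem coeff_CPoly {n : ℕ} (Δ : Set (EuclideanSpace ℝ (Fin n))) (v : EuclideanSpace ℝ (Fin n))
    (V : Set (EuclideanSpace ℝ (Fin n))) {k : ℕ} (hk : k ≤ aggDim Δ V) :
    (CPoly Δ v V).coeff (aggDim Δ V - k) =
      (k.factorial : ℝ) / ((aggDim Δ V).factorial : ℝ) * C Δ v V k := by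
  rw [CPoly, Polynomial.finsetSum_coeff, Finset.sum_eq_single_of_mem k
    (Finset.mem_range.2 (by omega))]
  · rw [Polynomial.coeff_C_mul_X_pow, if_pos rfl]
  · intro j hj hjk
    rw [Polynomial.coeff_C_mul_X_pow, if_neg]
    have := Finset.mem_range.1 hj
    omega

/-- In the Leibniz rule with d = `aggDim Δ V`, the factor (d choose k) (d - k)! cancels the
normalization k! / d!. Terms with k > d vanish. -/
theorem iteratedDeriv_CPoly_mul {n : ℕ} (Δ : Set (EuclideanSpace ℝ (Fin n)))
    (v : EuclideanSpace ℝ (Fin n)) (V : Set (EuclideanSpace ℝ (Fin n))) {f : ℝ → ℝ}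
    (hf : ContDiff ℝ n f) (β : ℝ) :
    iteratedDeriv (aggDim Δ V) (fun z : ℝ => (CPoly Δ v V).eval z * f (z + β)) 0 =
      ∑ k ∈ Finset.range (n + 1), C Δ v V k * iteratedDeriv k f β := by
  have hdn : aggDim Δ V ≤ n := by simpa using aggDim_le (P := Δ) V
  have hfd : ContDiff ℝ (aggDim Δ V) fun z => f (z + β) :=
    (hf.of_le (by exact_mod_cast hdn)).comp (contDiff_id.add contDiff_const)
  rw [iteratedDeriv_fun_mul (contDiff_polynomial_eval _).contDiffAt hfd.contDiffAt, ← Finset.sum_flip]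
  refine (Finset.sum_congr rfl fun k hk => ?_).trans (Finset.sum_subset
    (Finset.range_mono (Nat.succ_le_succ hdn)) fun k _ hk => ?_)
  · have hk : k ≤ aggDim Δ V := Nat.lt_succ_iff.1 (Finset.mem_range.1 hk)
    rw [Nat.sub_sub_self hk, iteratedDeriv_comp_add_const, iteratedDeriv_polynomial_eval]
    beta_reduce
    rw [zero_add, ← Polynomial.coeff_zero_eq_eval_zero, Polynomial.coeff_iterate_derivative, zero_add,
      Nat.descFactorial_self, coeff_CPoly _ _ _ hk, nsmul_eq_mul, Nat.choose_symm hk,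
      Nat.cast_choose ℝ hk]
    have h1 := (aggDim Δ V).factorial_ne_zero
    have h2 := k.factorial_ne_zero
    have h3 := (aggDim Δ V - k).factorial_ne_zero
    field_simp
  · rw [C, aggCoeff_of_aggDim_lt _ _ (by simpa using hk), zero_mul]

/-- A bump function times `(x - c) ^ k` is that power near `c`, where only its `k`-th derivative is
nonzero, and vanishes near the other points of `T`. -/
theorem exists_contDiff_isolating (T : Finset ℝ) (c : ℝ) (k : ℕ) : ∃ f : ℝ → ℝ,
    (∀ n : ℕ, ContDiff ℝ n f) ∧ (∀ d ∈ T, d ≠ c → ∀ j, iteratedDeriv j f d = 0) ∧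
    iteratedDeriv k f c ≠ 0 ∧ ∀ j, j ≠ k → iteratedDeriv j f c = 0 := by
  classical
  have hopen : (↑(T.erase c) : Set ℝ)ᶜ ∈ nhds c :=
    (T.erase c).finite_toSet.isClosed.isOpen_compl.mem_nhds (by simp)
  obtain ⟨ε, hε, hball⟩ := Metric.mem_nhds_iff.1 hopen
  let b : ContDiffBump c := ⟨ε / 3, ε / 2, by positivity, by linarith⟩
  have hj : ∀ j, iteratedDeriv j (fun x => b x * (x - c) ^ k) c =
      if j = k then (k.factorial : ℝ) else 0 := by
    intro j
    have he : (fun x => b x * (x - c) ^ k) =ᶠ[nhds c] fun x => (x - c) ^ k := by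
      filter_upwards [b.eventuallyEq_one] with x hx
      rw [hx]; simp
    rw [he.iteratedDeriv_eq j, iteratedDeriv_comp_sub_const j (fun x => x ^ k)]
    beta_reduce
    rw [sub_self, iteratedDeriv_fun_pow_zero]
    push_cast
    rfl
  refine ⟨fun x => b x * (x - c) ^ k,
    fun n => b.contDiff.mul ((contDiff_id.sub contDiff_const).pow k), ?_, ?_, ?_⟩
  · intro d hd hdc j
    have hd' : d ∉ tsupport b := by
      rw [b.tsupport_eq]
      intro h
      exact hball (Metric.closedBall_subset_ball (show b.rOut < ε by change ε / 2 < ε; linarith) h)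
        (by simp [hd, hdc])
    have he : (fun x => b x * (x - c) ^ k) =ᶠ[nhds d] fun _ => 0 := by
      filter_upwards [notMem_tsupport_iff_eventuallyEq.1 hd'] with x hx
      rw [hx]; simp
    rw [he.iteratedDeriv_eq j]
    simp
  · rw [hj, if_pos rfl]
    exact_mod_cast k.factorial_ne_zero
  · intro j hjk
    rw [hj, if_neg hjk]

/-! ### Sums over aggregates and uniqueness -/

section Main

variable {n : ℕ} {Δ : Set (EuclideanSpace ℝ (Fin n))} (v : EuclideanSpace ℝ (Fin n))

theorem finite_aggregates (hΔ : IsPolytope Δ) : (aggregates Δ v).Finite := by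
  rw [aggregates_eq_image]
  exact (finite_levels hΔ v).image _

theorem finsum_aggregates (hΔ : IsPolytope Δ) (Φ : Set (EuclideanSpace ℝ (Fin n)) → ℝ) :
    ∑ᶠ V ∈ aggregates Δ v, Φ V = ∑ c ∈ (finite_levels hΔ v).toFinset, Φ (levelUnion Δ v c) := by
  rw [aggregates_eq_image, finsum_mem_image (injOn_levelUnion Δ v),
    finsum_mem_eq_finite_toFinset_sum _ (finite_levels hΔ v)]

theorem setIntegral_eq_sum_aggregates (hΔ : IsPolytope Δ) (hd : setDim Δ = n) {f : ℝ → ℝ}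
    (hf : ContDiff ℝ n f) : ∫ x in Δ, iteratedDeriv n f ⟪v, x⟫ =
      ∑ᶠ V ∈ aggregates Δ v, ∑ k ∈ Finset.range (n + 1),
        C Δ v V k * iteratedDeriv k f (value v V) := by
  rw [finsum_aggregates v hΔ, setIntegral_iteratedDeriv_eq_sum_levels n _ Δ v f
    (finite_levels hΔ v).toFinset hΔ (by simp) hd hf (by simp)]
  refine Finset.sum_congr rfl fun c hc => Finset.sum_congr rfl fun k _ => ?_
  rw [value_levelUnion ((finite_levels hΔ v).mem_toFinset.1 hc), C]

theorem coeff_unique (hΔ : IsPolytope Δ) (hd : setDim Δ = n)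
    {c : Set (EuclideanSpace ℝ (Fin n)) → ℕ → ℝ}
    (hc : ∀ f : ℝ → ℝ, ContDiff ℝ n f → ∫ x in Δ, iteratedDeriv n f ⟪v, x⟫ =
      ∑ᶠ V ∈ aggregates Δ v, ∑ k ∈ Finset.range (n + 1), c V k * iteratedDeriv k f (value v V))
    {V : Set (EuclideanSpace ℝ (Fin n))} (hV : V ∈ aggregates Δ v) {k : ℕ} (hk : k ≤ n) :
    c V k = C Δ v V k := by
  rw [aggregates_eq_image] at hV
  obtain ⟨s, hs, rfl⟩ := hV
  have hmem : ∀ t, t ∈ (finite_levels hΔ v).toFinset ↔ t ∈ levels Δ v := fun t =>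
    (finite_levels hΔ v).mem_toFinset
  obtain ⟨f, hf, hfT, hfk, hfj⟩ := exists_contDiff_isolating (finite_levels hΔ v).toFinset s k
  have isolate : ∀ c' : Set (EuclideanSpace ℝ (Fin n)) → ℕ → ℝ,
      ∑ᶠ V ∈ aggregates Δ v, ∑ k ∈ Finset.range (n + 1), c' V k * iteratedDeriv k f (value v V) =
        c' (levelUnion Δ v s) k * iteratedDeriv k f s := by
    intro c'
    rw [finsum_aggregates v hΔ, Finset.sum_eq_single_of_mem s ((hmem s).2 hs),
      Finset.sum_eq_single_of_mem k (Finset.mem_range.2 (by omega)), value_levelUnion hs]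
    · intro j _ hjk
      rw [value_levelUnion hs, hfj j hjk, mul_zero]
    · intro t ht hts
      refine Finset.sum_eq_zero fun j _ => ?_
      rw [value_levelUnion ((hmem t).1 ht), hfT t ht hts, mul_zero]
  have h1 := hc f (hf n)
  rw [setIntegral_eq_sum_aggregates v hΔ hd (hf n), isolate, isolate] at h1
  exact (mul_right_cancel₀ hfk h1).symm

end Main

/-! ### Simplices and Brion's formula -/

section Simplex

variable {n : ℕ} {ν : Fin (n + 1) → EuclideanSpace ℝ (Fin n)}

/-- The vertices of a full-dimensional simplex as an affine basis. -/
def simplexBasis (hν : AffineIndependent ℝ ν) :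
    AffineBasis (Fin (n + 1)) ℝ (EuclideanSpace ℝ (Fin n)) :=
  ⟨ν, hν, hν.affineSpan_eq_top_iff_card_eq_finrank_add_one.2 (by simp)⟩

@[simp] theorem simplexBasis_apply (hν : AffineIndependent ℝ ν) (i : Fin (n + 1)) :
    simplexBasis hν i = ν i := rfl

theorem mem_simplex_iff (hν : AffineIndependent ℝ ν) {x : EuclideanSpace ℝ (Fin n)} :
    x ∈ convexHull ℝ (Set.range ν) ↔ ∀ i, 0 ≤ (simplexBasis hν).coord i x := by
  have := (simplexBasis hν).convexHull_eq_nonneg_coord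
  exact Set.ext_iff.1 this x

theorem vertex_mem_simplex (i : Fin (n + 1)) : ν i ∈ convexHull ℝ (Set.range ν) :=
  subset_convexHull ℝ _ ⟨i, rfl⟩

theorem eq_vertex_of_coord_eq_zero (hν : AffineIndependent ℝ ν) {i : Fin (n + 1)}
    {x : EuclideanSpace ℝ (Fin n)} (h : ∀ j, j ≠ i → (simplexBasis hν).coord j x = 0) :
    x = ν i := by
  have h1 := (simplexBasis hν).sum_coord_apply_eq_one x
  rw [Finset.sum_eq_single_of_mem i (Finset.mem_univ _) fun j _ hj => h j hj] at h1
  rw [← (simplexBasis hν).linear_combination_coord_eq_self x,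
    Finset.sum_eq_single_of_mem i (Finset.mem_univ _) fun j _ hj => by rw [h j hj, zero_smul],
    h1, one_smul, simplexBasis_apply]

theorem coord_add_smul (hν : AffineIndependent ℝ ν) (j : Fin (n + 1))
    (x y : EuclideanSpace ℝ (Fin n)) {s t : ℝ} (hst : s + t = 1) :
    (simplexBasis hν).coord j (s • x + t • y) =
      s * (simplexBasis hν).coord j x + t * (simplexBasis hν).coord j y :=
  Convex.combo_affine_apply hst

theorem isPolytope_simplex (hν : AffineIndependent ℝ ν) :
    IsPolytope (convexHull ℝ (Set.range ν)) := by
  classical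
  refine ⟨⟨_, vertex_mem_simplex 0⟩, isBounded_convexHull.2 (Set.finite_range ν).isBounded,
    Finset.univ.image fun i => ((InnerProductSpace.toDual ℝ _).symm
      ((simplexBasis hν).coord i).linear.toContinuousLinearMap, (simplexBasis hν).coord i 0), ?_⟩
  ext x
  rw [mem_simplex_iff hν]
  simp only [Set.mem_ofPred_eq, Finset.forall_mem_image, Finset.mem_univ, true_imp_iff,
    InnerProductSpace.toDual_symm_apply, LinearMap.coe_toContinuousLinearMap']
  refine forall_congr' fun i => ?_
  rw [((simplexBasis hν).coord i).decomp]
  simp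

theorem setDim_simplex (hν : AffineIndependent ℝ ν) :
    setDim (convexHull ℝ (Set.range ν)) = n := by
  have h : affineSpan ℝ (Set.range ν) = ⊤ := (simplexBasis hν).tot
  rw [setDim, ← direction_affineSpan, affineSpan_convexHull, h, AffineSubspace.direction_top,
    finrank_top]
  simp

theorem isFace_vertex (hν : AffineIndependent ℝ ν) (i : Fin (n + 1)) :
    IsFace (convexHull ℝ (Set.range ν)) {ν i} := by
  refine ⟨Set.singleton_nonempty _, convex_singleton _,
    Set.singleton_subset_iff.2 (vertex_mem_simplex i), ?_⟩
  rintro x hx y hy z rfl ⟨s, t, hs, ht, hst, hz⟩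
  refine eq_vertex_of_coord_eq_zero hν fun j hj => ?_
  have h1 := coord_add_smul hν j x y hst
  rw [hz, ← simplexBasis_apply hν, (simplexBasis hν).coord_apply_ne hj] at h1
  have h2 := (mem_simplex_iff hν).1 hx j
  have h3 := (mem_simplex_iff hν).1 hy j
  have h4 := mul_nonneg ht.le h3
  nlinarith

/-- A positive coordinate at `i` allows `x` to be pushed away from `ν i` within the simplex, so `x`
is strictly between `ν i` and another point of it. -/
theorem vertex_mem_face (hν : AffineIndependent ℝ ν) {G : Set (EuclideanSpace ℝ (Fin n))}
    (hG : IsFace (convexHull ℝ (Set.range ν)) G) {x : EuclideanSpace ℝ (Fin n)} (hx : x ∈ G)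
    {i : Fin (n + 1)} (hi : 0 < (simplexBasis hν).coord i x) : ν i ∈ G := by
  set ε := (simplexBasis hν).coord i x
  have hxS := (mem_simplex_iff hν).1 (hG.subset hx)
  -- Taking `ε` to be the coordinate itself is safe: the new `i`-th coordinate is `(1 + ε) * ε - ε =
  -- ε ^ 2`.
  have hy : (1 + ε) • x + (-ε) • ν i ∈ convexHull ℝ (Set.range ν) := by
    rw [mem_simplex_iff hν]
    intro j
    rw [coord_add_smul hν j _ _ (by ring)]
    by_cases hj : j = i
    · subst hj
      rw [← simplexBasis_apply hν, (simplexBasis hν).coord_apply_eq]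
      change 0 ≤ (1 + ε) * ε + -ε * 1
      nlinarith
    · rw [← simplexBasis_apply hν, (simplexBasis hν).coord_apply_ne hj]
      have := hxS j
      have : 0 ≤ (1 + ε) * (simplexBasis hν).coord j x := by positivity
      linarith
  refine hG.2.2.left_mem_of_mem_openSegment (vertex_mem_simplex i) hy hx
    ⟨ε / (1 + ε), 1 / (1 + ε), by positivity, by positivity, by field_simp; ring, ?_⟩
  have h1 : 1 + ε ≠ 0 := by positivity
  have e : (ε / (1 + ε)) • ν i + (1 / (1 + ε)) • ((1 + ε) • x + (-ε) • ν i) =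
      (ε / (1 + ε) - 1 / (1 + ε) * ε) • ν i + (1 / (1 + ε) * (1 + ε)) • x := by module
  have e1 : ε / (1 + ε) - 1 / (1 + ε) * ε = 0 := by ring
  rw [e, e1, one_div_mul_cancel h1, zero_smul, zero_add, one_smul]

variable {v : EuclideanSpace ℝ (Fin n)}

/-- Two positive barycentric coordinates would put two vertices in one face of constant level. -/
theorem eq_vertex_of_mem_levelUnion (hν : AffineIndependent ℝ ν)
    (hv : ∀ i j, i ≠ j → ⟪v, ν i⟫ ≠ ⟪v, ν j⟫) {c : ℝ} {x : EuclideanSpace ℝ (Fin n)}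
    (hx : x ∈ levelUnion (convexHull ℝ (Set.range ν)) v c) : ∃ i, x = ν i := by
  obtain ⟨G, ⟨hG, hGc⟩, hx⟩ := hx
  have hxS := (mem_simplex_iff hν).1 (hG.subset hx)
  obtain ⟨i, -, hi⟩ : ∃ i ∈ Finset.univ, 0 < (simplexBasis hν).coord i x :=
    Finset.exists_lt_of_sum_lt (s := Finset.univ) (f := fun _ => (0 : ℝ)) (by
      rw [(simplexBasis hν).sum_coord_apply_eq_one x]; simp)
  refine ⟨i, eq_vertex_of_coord_eq_zero hν fun j hj => ?_⟩
  by_contra hne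
  have hj' := lt_of_le_of_ne (hxS j) (Ne.symm hne)
  exact hv j i hj ((hGc _ (vertex_mem_face hν hG hx hj')).trans
    (hGc _ (vertex_mem_face hν hG hx hi)).symm)

theorem levelUnion_simplex (hν : AffineIndependent ℝ ν)
    (hv : ∀ i j, i ≠ j → ⟪v, ν i⟫ ≠ ⟪v, ν j⟫) (i : Fin (n + 1)) :
    levelUnion (convexHull ℝ (Set.range ν)) v ⟪v, ν i⟫ = {ν i} := by
  ext x
  constructor
  · intro hx
    obtain ⟨j, rfl⟩ := eq_vertex_of_mem_levelUnion hν hv hx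
    have h := inner_of_mem_levelUnion hx
    by_contra hne
    exact hv j i (fun h => hne (by rw [h]; rfl)) h
  · rintro rfl
    exact ⟨{ν i}, ⟨isFace_vertex hν i, by rintro _ rfl; rfl⟩, rfl⟩

theorem aggregates_simplex (hν : AffineIndependent ℝ ν)
    (hv : ∀ i j, i ≠ j → ⟪v, ν i⟫ ≠ ⟪v, ν j⟫) :
    aggregates (convexHull ℝ (Set.range ν)) v =
      Set.range fun i => ({ν i} : Set (EuclideanSpace ℝ (Fin n))) := by
  ext V
  constructor
  · rintro ⟨⟨x, hx⟩, c, rfl⟩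
    obtain ⟨i, rfl⟩ := eq_vertex_of_mem_levelUnion hν hv hx
    obtain rfl := inner_of_mem_levelUnion hx
    exact ⟨i, (levelUnion_simplex hν hv i).symm⟩
  · rintro ⟨i, rfl⟩
    exact ⟨Set.singleton_nonempty _, _, (levelUnion_simplex hν hv i).symm⟩

theorem C_vertex_of_pos {Δ : Set (EuclideanSpace ℝ (Fin n))} (x : EuclideanSpace ℝ (Fin n)) {k : ℕ}
    (hk : 1 ≤ k) : C Δ v {x} k = 0 := by
  refine aggCoeff_of_aggDim_lt _ _ (Nat.lt_of_le_of_lt (csSup_le' ?_) hk)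
  rintro _ ⟨G, -, hG, rfl⟩
  have h : vectorSpan ℝ G ≤ ⊥ := by
    rw [← vectorSpan_singleton ℝ x]
    exact vectorSpan_mono ℝ hG
  rw [setDim, le_bot_iff.1 h, finrank_bot]

theorem value_singleton (x : EuclideanSpace ℝ (Fin n)) : value v {x} = ⟪v, x⟫ := by
  have h : ({x} : Set (EuclideanSpace ℝ (Fin n))).Nonempty := Set.singleton_nonempty x
  rw [value, dif_pos h]
  exact congrArg _ h.some_mem

theorem setIntegral_simplex_eq_sum (hν : AffineIndependent ℝ ν)
    (hv : ∀ i j, i ≠ j → ⟪v, ν i⟫ ≠ ⟪v, ν j⟫) {f : ℝ → ℝ} (hf : ContDiff ℝ n f) :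
    ∫ x in convexHull ℝ (Set.range ν), iteratedDeriv n f ⟪v, x⟫ =
      ∑ i, C (convexHull ℝ (Set.range ν)) v {ν i} 0 * f ⟪v, ν i⟫ := by
  rw [setIntegral_eq_sum_aggregates v (isPolytope_simplex hν) (setDim_simplex hν) hf,
    aggregates_simplex hν hv, finsum_mem_range (fun i j h => hν.injective (by simpa using h)),
    finsum_eq_sum_of_fintype]
  refine Finset.sum_congr rfl fun i _ => ?_
  rw [Finset.sum_eq_single_of_mem 0 (by simp) fun k _ hk => by
    rw [C_vertex_of_pos _ (Nat.one_le_iff_ne_zero.2 hk), zero_mul], value_singleton,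
    iteratedDeriv_zero]

theorem iterate_derivative_natDegree_of_monic {p : Polynomial ℝ} (hp : p.Monic) :
    Polynomial.derivative^[p.natDegree] p = Polynomial.C (p.natDegree.factorial : ℝ) := by
  ext k
  rw [Polynomial.coeff_iterate_derivative, Polynomial.coeff_C]
  split_ifs with hk
  · rw [hk, zero_add, Nat.descFactorial_self, hp.coeff_natDegree, nsmul_eq_mul, mul_one]
  · rw [Polynomial.coeff_eq_zero_of_natDegree_lt (by omega), smul_zero]

theorem C_simplex (hν : AffineIndependent ℝ ν) (hv : ∀ i j, i ≠ j → ⟪v, ν i⟫ ≠ ⟪v, ν j⟫)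
    (i : Fin (n + 1)) : C (convexHull ℝ (Set.range ν)) v {ν i} 0 =
      (n.factorial : ℝ) * (volume (convexHull ℝ (Set.range ν))).toReal /
        ∏ j ∈ Finset.univ.erase i, ⟪ν i - ν j, v⟫ := by
  -- Testing with `p` removes every other vertex from the sum, while its `n`-th derivative is the
  -- constant `n!`.
  let p : Polynomial ℝ := ∏ j ∈ Finset.univ.erase i, (Polynomial.X - Polynomial.C ⟪v, ν j⟫)
  have hp : p.Monic := Polynomial.monic_prod_of_monic _ _ fun j _ => Polynomial.monic_X_sub_C _
  have hpn : p.natDegree = n := by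
    rw [Polynomial.natDegree_prod_of_monic _ _ fun j _ => Polynomial.monic_X_sub_C _]
    simp
  have heval : ∀ t, p.eval t = ∏ j ∈ Finset.univ.erase i, (t - ⟪v, ν j⟫) := by
    intro t; rw [Polynomial.eval_prod]; simp
  have h := setIntegral_simplex_eq_sum hν hv (contDiff_polynomial_eval p)
  have hder : iteratedDeriv n (fun z => p.eval z) = fun _ => (n.factorial : ℝ) := by
    have := iterate_derivative_natDegree_of_monic hp
    rw [hpn] at this
    rw [iteratedDeriv_polynomial_eval, this]
    simp
  have hprod : ∏ j ∈ Finset.univ.erase i, ⟪ν i - ν j, v⟫ = p.eval ⟪v, ν i⟫ := by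
    rw [heval]
    refine Finset.prod_congr rfl fun j _ => ?_
    rw [real_inner_comm, inner_sub_right]
  have hne : p.eval ⟪v, ν i⟫ ≠ 0 := by
    rw [heval]
    refine Finset.prod_ne_zero_iff.2 fun j hj => sub_ne_zero.2 ?_
    exact hv i j (Finset.ne_of_mem_erase hj).symm
  rw [hder, Finset.sum_eq_single_of_mem i (Finset.mem_univ _) fun j _ hj => by
    rw [heval, Finset.prod_eq_zero (Finset.mem_erase.2 ⟨hj, Finset.mem_univ j⟩) (sub_self _),
      mul_zero]] at h
  rw [hprod, eq_div_iff hne, ← h]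
  simp [Measure.real, mul_comm]

end Simplex

end PolytopeIntegration

end

theorem mainTheorem10 (n : ℕ) :
    (∀ (Δ : Set (EuclideanSpace ℝ (Fin n))) (u : EuclideanSpace ℝ (Fin n)),
      PolytopeIntegration.IsPolytope Δ → PolytopeIntegration.setDim Δ = n →
        -- there are finitely many aggregates, so that the sums over them below are honest
        (PolytopeIntegration.aggregates Δ u).Finite ∧
        -- the integration formula, in both of its forms
        (∀ f : ℝ → ℝ, ContDiff ℝ n f →
          (∫ x in Δ, iteratedDeriv n f ⟪u, x⟫ =
            ∑ᶠ V ∈ PolytopeIntegration.aggregates Δ u,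
              iteratedDeriv (PolytopeIntegration.aggDim Δ V)
                (fun z : ℝ => (PolytopeIntegration.CPoly Δ u V).eval z *
                  f (z + PolytopeIntegration.value u V)) 0) ∧
          (∫ x in Δ, iteratedDeriv n f ⟪u, x⟫ =
            ∑ᶠ V ∈ PolytopeIntegration.aggregates Δ u,
              ∑ k ∈ Finset.range (n + 1),
                PolytopeIntegration.C Δ u V k *
                  iteratedDeriv k f (PolytopeIntegration.value u V))) ∧
        -- the coefficients are uniquely determined by the formula
        (∀ c : Set (EuclideanSpace ℝ (Fin n)) → ℕ → ℝ,
          (∀ f : ℝ → ℝ, ContDiff ℝ n f →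
            ∫ x in Δ, iteratedDeriv n f ⟪u, x⟫ =
              ∑ᶠ V ∈ PolytopeIntegration.aggregates Δ u,
                ∑ k ∈ Finset.range (n + 1),
                  c V k * iteratedDeriv k f (PolytopeIntegration.value u V)) →
          ∀ V ∈ PolytopeIntegration.aggregates Δ u, ∀ k ≤ n,
            c V k = PolytopeIntegration.C Δ u V k)) ∧
    -- the case of a simplex and of a direction that separates its vertices
    (∀ (ν : Fin (n + 1) → EuclideanSpace ℝ (Fin n)) (u : EuclideanSpace ℝ (Fin n)),
      AffineIndependent ℝ ν → (∀ i j, i ≠ j → ⟪u, ν i⟫ ≠ ⟪u, ν j⟫) →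
        PolytopeIntegration.aggregates (convexHull ℝ (Set.range ν)) u =
          Set.range (fun i => ({ν i} : Set (EuclideanSpace ℝ (Fin n)))) ∧
        (∀ i, PolytopeIntegration.C (convexHull ℝ (Set.range ν)) u {ν i} 0 =
          (n.factorial : ℝ) * (volume (convexHull ℝ (Set.range ν))).toReal /
            ∏ j ∈ Finset.univ.erase i, ⟪ν i - ν j, u⟫) ∧
        (∀ i, ∀ k ≥ 1, PolytopeIntegration.C (convexHull ℝ (Set.range ν)) u {ν i} k = 0) ∧
        ∀ f : ℝ → ℝ, ContDiff ℝ n f →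
          ∫ x in convexHull ℝ (Set.range ν), iteratedDeriv n f ⟪u, x⟫ =
            (n.factorial : ℝ) * (volume (convexHull ℝ (Set.range ν))).toReal *
              ∑ i, f ⟪u, ν i⟫ / ∏ j ∈ Finset.univ.erase i, ⟪ν i - ν j, u⟫) := by
  refine ⟨fun Δ u hΔ hd => ⟨PolytopeIntegration.finite_aggregates u hΔ, fun f hf => ⟨?_, ?_⟩,
    fun c hc V hV k hk => PolytopeIntegration.coeff_unique u hΔ hd hc hV hk⟩,
    fun ν u hν hu => ⟨PolytopeIntegration.aggregates_simplex hν hu,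
      PolytopeIntegration.C_simplex hν hu,
      fun i k hk => PolytopeIntegration.C_vertex_of_pos (ν i) hk, fun f hf => ?_⟩⟩
  · simp only [PolytopeIntegration.iteratedDeriv_CPoly_mul Δ u _ hf]
    exact PolytopeIntegration.setIntegral_eq_sum_aggregates u hΔ hd hf
  · exact PolytopeIntegration.setIntegral_eq_sum_aggregates u hΔ hd hf
  · rw [PolytopeIntegration.setIntegral_simplex_eq_sum hν hu hf, Finset.mul_sum]
    refine Finset.sum_congr rfl fun i _ => ?_
    rw [PolytopeIntegration.C_simplex hν hu]
    ring
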